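/- Let $p=(p_x)_{x\in\mathbb N}$, $\mathbb N=\{0,1,2,\dots\}$, be a decreasing (that is, $p_x\ge p_{x+1}$) probability mass function with $\kappa=\sup\{x:p_x>0\}<\infty$, and let $X_1,X_2,\dots$ be i.i.d. with mass function $p$. *Estimators.* Let $\widehat p_{n,x}=n^{-1}\#\{i\le n: X_i=x\}$. For a finite vector $w=(w_0,\dots,w_m)$ let $\mathrm{rear}(w)$ be its entries in decreasing order and let $\mathrm{gren}(w)$ be the vector of the $m+1$ slopes, over the intervals $[x-1,x]$, $x=0,\dots,m$, of the least concave majorant of the points $\bigl(j,\sum_{i=0}^{j}w_i\bigr)$, $j=-1,0,\dots,m$. Put $\widehat p_n^R=\mathrm{rear}(\widehat p_n)$ and $\widehat p^G_n=\mathrm{gren}(\widehat p_n)$, where $\widehat p_n$ is regarded as a vector on $\{0,\dots,\max_{i\le n}X_i\}$ and the results are extended by $0$. Let $q_x=-(x+1)(p_{x+1}-p_x)$ be the mixing distribution of $p$; let $\widehat q_n,\widehat q_n^R,\widehat q_n^G$ be obtained by the same formula from $\widehat p_n,\widehat p_n^R,\widehat p_n^G$; and let $Z_n=\sqrt n(\widehat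 q_n-q)$, $Z_n^R=\sqrt n(\widehat q_n^R-q)$, $Z_n^G=\sqrt n(\widehat q_n^G-q)$. *Limits.* Let $Y=(Y_x)_{x\in\mathbb N}$ be a centred Gaussian process with $\mathrm{Cov}(Y_x,Y_{x'})=p_x\delta_{x,x'}-p_xp_{x'}$. Let $Y^R$ (resp. $Y^G$) be obtained from $Y$ by applying $\mathrm{rear}$ (resp. $\mathrm{gren}$) separately to $(Y_r,\dots,Y_s)$ for every maximal interval $\{r,\dots,s\}\subseteq\{0,\dots,\kappa\}$ on which $p$ is constant. Put $Z_x=-(x+1)(Y_{x+1}-Y_x)$, $Z^R_x=-(x+1)(Y^R_{x+1}-Y^R_x)$, $Z^G_x=-(x+1)(Y^G_{x+1}-Y^G_x)$. Then, as $n\to\infty$: 1. $Z_n\Rightarrow Z$, $Z_n^R\Rightarrow Z^R$ and $Z_n^G\Rightarrow Z^G$ weakly in $\ell_k$, for every $1\le k\le\infty$. 2. For every $1\le k\le\infty$, $\|Z_n\|_k\to_d\|Z\|_k$, $\|Z_n^R\|_k\to_d\|Z^R\|_k$ and $\|Z_n^G\|_k\to_d\|Z^G\|_k$, and these convergences also hold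 in expectation; for $k<\infty$ the same is true of the $k$-th powers of these norms. 3. Let $H^2(a,b)=\frac12\sum_{x\ge0}|\sqrt{a_x}-\sqrt{b_x}|^2$, where $\sqrt t=i\sqrt{|t|}$ for $t<0$ (this occurs only for $\widehat q_n$, whose entries may be negative). Then, as $[0,\infty]$-valued random variables, $$nH^2(\widehat q_n,q)\to_d\frac18\sum_{x=0}^{\kappa}\frac{Z_x^2}{q_x},\qquad nH^2(\widehat q_n^R,q)\to_d\frac18\sum_{x=0}^{\kappa}\frac{(Z_x^R)^2}{q_x},\qquad nH^2(\widehat q_n^G,q)\to_d\frac18\sum_{x=0}^{\kappa}\frac{(Z_x^G)^2}{q_x},$$ where $c/0=\infty$ for $c>0$ and $0/0=0$; and the expectations (in $[0,\infty]$) converge to the expectations of the limits. -/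

import Mathlib

open MeasureTheory ProbabilityTheory Filter Topology
open scoped ENNReal

noncomputable section

namespace DiscreteMonotone

/-! ### Monotone mass functions -/

/-- `p` is a decreasing (non-increasing) probability mass function on `ℕ`. -/
structure IsDecreasingPMF (p : ℕ → ℝ) : Prop where
  nonneg : ∀ x, 0 ≤ p x
  hasSum : HasSum p 1
  antitone : Antitone p

/-- `κ = sup {x : p_x > 0}`. -/
def supportEnd (p : ℕ → ℝ) : ℕ := sSup {x | 0 < p x}

/-- The sequence `-(x+1) Δ w_x = -(x+1) (w_{x+1} - w_x)`. For a mass function `w` this is its mixing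
distribution. -/
def mixing (w : ℕ → ℝ) : ℕ → ℝ := fun x => -((x : ℝ) + 1) * (w (x + 1) - w x)

/-! ### The operators `rear` and `gren`

Both act on the vector `(w 0, …, w (m - 1))`; the entries of the result outside `{0, …, m - 1}`
are set to `0`. -/

/-- The entries `w 0, …, w (m - 1)` listed in decreasing order. -/
def rear (m : ℕ) (w : ℕ → ℝ) : ℕ → ℝ := fun x =>
  if h : x < m then w (Tuple.sort (fun i : Fin m => -w i) ⟨x, h⟩) else 0

/-- The least concave majorant on `[0, m]` of the points `(j, w 0 + … + w (j - 1))`,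
`j = 0, …, m`, evaluated at `t`. (The abscissa is shifted by one, so that the partial sum up to and
including index `j` is attached to `j + 1` and the empty sum to `0`.) -/
def concaveMajorant (m : ℕ) (w : ℕ → ℝ) (t : ℝ) : ℝ :=
  sInf ((fun g : ℝ → ℝ => g t) ''
    {g | ConcaveOn ℝ (Set.Icc 0 (m : ℝ)) g ∧
      ∀ j : ℕ, j ≤ m → ∑ i ∈ Finset.range j, w i ≤ g j})

/-- The `m` slopes of the least concave majorant of the partial sums. -/
def gren (m : ℕ) (w : ℕ → ℝ) : ℕ → ℝ := fun x =>
  if x < m then concaveMajorant m w ((x : ℝ) + 1) - concaveMajorant m w (x : ℝ) else 0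

/-! ### The estimators -/

variable {Ω : Type*}

/-- Empirical mass function of `X_0, …, X_{n-1}`. -/
def empirical (X : ℕ → Ω → ℕ) (n : ℕ) (ω : Ω) : ℕ → ℝ := fun x =>
  (n : ℝ)⁻¹ * ∑ i ∈ Finset.range n, if X i ω = x then (1 : ℝ) else 0

/-- Length `max {X_0, …, X_{n-1}} + 1` of the vector of empirical frequencies. -/
def sampleLength (X : ℕ → Ω → ℕ) (n : ℕ) (ω : Ω) : ℕ :=
  (Finset.range n).sup (fun i => X i ω) + 1

/-- The rearrangement estimator. -/
def rearEstimator (X : ℕ → Ω → ℕ) (n : ℕ) (ω : Ω) : ℕ → ℝ :=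
  rear (sampleLength X n ω) (empirical X n ω)

/-- The Grenander estimator (the maximum likelihood estimator under monotonicity). -/
def grenEstimator (X : ℕ → Ω → ℕ) (n : ℕ) (ω : Ω) : ℕ → ℝ :=
  gren (sampleLength X n ω) (empirical X n ω)

/-- The process `√n (q̂_{n,x} - q_x)`, where `q̂_n` and `q` are the mixing distributions of the
estimator `phat n` and of `p`. -/
def mixingFluctuation (p : ℕ → ℝ) (phat : ℕ → Ω → ℕ → ℝ) (n : ℕ) (ω : Ω) : ℕ → ℝ := fun x =>
  √(n : ℝ) * (mixing (phat n ω) x - mixing p x)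

/-! ### The limit processes -/

/-- `Y` is a centred Gaussian process with covariances `p_x δ_{x,x'} - p_x p_{x'}`. -/
structure IsLimitGaussian [MeasurableSpace Ω] (p : ℕ → ℝ) (Y : ℕ → Ω → ℝ) (P : Measure Ω) :
    Prop where
  gaussian : IsGaussianProcess Y P
  mean : ∀ x, ∫ ω, Y x ω ∂P = 0
  cov : ∀ x x', covariance (Y x) (Y x') P = (if x = x' then p x else 0) - p x * p x'

/-- The operator `φ` applied to `y` separately on each interval of constancy
`{r, …, s} = {z : p_z = p_x}` of `p` inside the support of `p`; here `r` is the minimum of that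
interval and its length `s - r + 1` is its cardinality. Outside the support `y` is unchanged. -/
def blockwise (φ : ℕ → (ℕ → ℝ) → ℕ → ℝ) (p : ℕ → ℝ) (y : ℕ → ℝ) : ℕ → ℝ := fun x =>
  if 0 < p x then
    φ {z | p z = p x}.ncard (fun i => y (sInf {z | p z = p x} + i)) (x - sInf {z | p z = p x})
  else y x

/-- `Y^R`. -/
def limitRear (p : ℕ → ℝ) (Y : ℕ → Ω → ℝ) (ω : Ω) : ℕ → ℝ := blockwise rear p (fun x => Y x ω)

/-- `Y^G`. -/
def limitGren (p : ℕ → ℝ) (Y : ℕ → Ω → ℝ) (ω : Ω) : ℕ → ℝ := blockwise gren p (fun x => Y x ω)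

/-! ### The Hellinger statistics -/

/-- Squared Hellinger distance `½ ∑ |√a_x - √b_x|²` of two real sequences, as an element of
`[0, ∞]`. As entries of `a` may be negative, `√` is the principal complex square root. -/
def hellingerSq (a b : ℕ → ℝ) : ℝ≥0∞ :=
  2⁻¹ * ∑' x, ENNReal.ofReal (‖(a x : ℂ) ^ (1 / 2 : ℂ) - (b x : ℂ) ^ (1 / 2 : ℂ)‖ ^ 2)

/-- On non-negative sequences `hellingerSq` is given by the usual formula. -/
theorem hellingerSq_of_nonneg {a b : ℕ → ℝ} (ha : ∀ x, 0 ≤ a x) (hb : ∀ x, 0 ≤ b x) :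
    hellingerSq a b = 2⁻¹ * ∑' x, ENNReal.ofReal ((√(a x) - √(b x)) ^ 2) := by
  have key : ∀ t : ℝ, 0 ≤ t → (t : ℂ) ^ (1 / 2 : ℂ) = ((√t : ℝ) : ℂ) := by
    intro t ht
    rw [Real.sqrt_eq_rpow, Complex.ofReal_cpow ht]
    norm_num
  unfold hellingerSq
  congr 1
  refine tsum_congr fun x => ?_
  rw [key _ (ha x), key _ (hb x), ← Complex.ofReal_sub, Complex.norm_real, Real.norm_eq_abs,
    sq_abs]

/-- `⅛ ∑_{x=0}^κ z_x² / q_x` in `[0, ∞]`, where `q` is the mixing distribution of `p`, with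
`c / 0 = ∞` for `c > 0` and `0 / 0 = 0`. -/
def weightedSq (p z : ℕ → ℝ) : ℝ≥0∞ :=
  8⁻¹ * ∑ x ∈ Finset.range (supportEnd p + 1),
    ENNReal.ofReal (z x ^ 2) / ENNReal.ofReal (mixing p x)

/-! ### Modes of convergence -/

/-- The sequence space `ℓ_k`, `1 ≤ k ≤ ∞`. -/
abbrev Ell (k : ℝ≥0∞) : Type := lp (fun _ : ℕ => ℝ) k

/-- The Borel σ-algebra of `ℓ_k`. -/
instance ellMeasurableSpace (k : ℝ≥0∞) [Fact (1 ≤ k)] : MeasurableSpace (Ell k) := borel _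

instance ellBorelSpace (k : ℝ≥0∞) [Fact (1 ≤ k)] : BorelSpace (Ell k) := ⟨rfl⟩

open Classical in
/-- A sequence as an element of `ℓ_k` (`0` if it does not belong to `ℓ_k`). -/
def toEll (k : ℝ≥0∞) (w : ℕ → ℝ) : Ell k :=
  if h : Memℓp w k then ⟨w, h⟩ else 0

variable {Ω' : Type*} [MeasurableSpace Ω] [MeasurableSpace Ω']

/-- The processes `W n` and `W'` have almost all paths in `ℓ_k`, and `W n` converges weakly to `W'`
in `ℓ_k`. -/
def WeaklyConvergesInEll (k : ℝ≥0∞) [Fact (1 ≤ k)] (W : ℕ → Ω → ℕ → ℝ) (W' : Ω' → ℕ → ℝ)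
    (P : Measure Ω) [IsProbabilityMeasure P] (P' : Measure Ω') [IsProbabilityMeasure P'] : Prop :=
  (∀ n, ∀ᵐ ω ∂P, Memℓp (W n ω) k) ∧ (∀ᵐ ω ∂P', Memℓp (W' ω) k) ∧
    TendstoInDistribution (fun n ω => toEll k (W n ω)) atTop (fun ω => toEll k (W' ω))
      (fun _ => P) P'

/-- Convergence in distribution of real random variables, together with integrability and
convergence of their expectations. -/
def ConvergesInLawAndMean (T : ℕ → Ω → ℝ) (T' : Ω' → ℝ)
    (P : Measure Ω) [IsProbabilityMeasure P] (P' : Measure Ω') [IsProbabilityMeasure P'] : Prop :=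
  TendstoInDistribution T atTop T' (fun _ => P) P' ∧
    (∀ n, Integrable (T n) P) ∧ Integrable T' P' ∧
    Tendsto (fun n => ∫ ω, T n ω ∂P) atTop (𝓝 (∫ ω, T' ω ∂P'))

/-- Convergence in distribution of `[0, ∞]`-valued random variables, together with convergence of
their expectations in `[0, ∞]`. -/
def ConvergesInLawAndMeanENN (T : ℕ → Ω → ℝ≥0∞) (T' : Ω' → ℝ≥0∞)
    (P : Measure Ω) [IsProbabilityMeasure P] (P' : Measure Ω') [IsProbabilityMeasure P'] : Prop :=
  TendstoInDistribution T atTop T' (fun _ => P) P' ∧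
    Tendsto (fun n => ∫⁻ ω, T n ω ∂P) atTop (𝓝 (∫⁻ ω, T' ω ∂P'))

/-- For an estimator `phat` of `p` and a process `y`: with `Z_n = √n (q̂_n - q)` and
`Z_x = -(x+1) (y_{x+1} - y_x)`, for every `1 ≤ k ≤ ∞` one has `Z_n ⇒ Z` in `ℓ_k`; the norms
`‖Z_n‖_k` converge to `‖Z‖_k` in distribution and in expectation, as do their `k`-th powers if
`k < ∞`; and `n H²(q̂_n, q)` converges to `⅛ ∑_{x ≤ κ} Z_x² / q_x` in distribution and in
expectation. -/
def MixingRate (p : ℕ → ℝ) (phat : ℕ → Ω → ℕ → ℝ) (y : Ω' → ℕ → ℝ)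
    (P : Measure Ω) [IsProbabilityMeasure P] (P' : Measure Ω') [IsProbabilityMeasure P'] : Prop :=
  (∀ (k : ℝ≥0∞) [Fact (1 ≤ k)],
    WeaklyConvergesInEll k (mixingFluctuation p phat) (fun ω => mixing (y ω)) P P' ∧
    ConvergesInLawAndMean (fun n ω => ‖toEll k (mixingFluctuation p phat n ω)‖)
      (fun ω => ‖toEll k (mixing (y ω))‖) P P' ∧
    (k ≠ ∞ → ConvergesInLawAndMean
      (fun n ω => ‖toEll k (mixingFluctuation p phat n ω)‖ ^ k.toReal)
      (fun ω => ‖toEll k (mixing (y ω))‖ ^ k.toReal) P P')) ∧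
  ConvergesInLawAndMeanENN (fun n ω => (n : ℝ≥0∞) * hellingerSq (mixing (phat n ω)) (mixing p))
    (fun ω => weightedSq p (mixing (y ω))) P P'

end DiscreteMonotone

end

/-!
On the event that the fluctuations of `p̂_n` are smaller than the gaps between the distinct values
of `p`, the operators `rear` and `gren` (and the plain truncation, which gives back `p̂_n`) act on
each interval of constancy of `p` separately. There they commute with the addition of constants and
with multiplication by non-negative scalars, so that `√n (q̂_n - q)` is eventually a fixed
continuous function of the empirical process `√n (p̂_n - p)`. Convergence in law thus follows from
the central limit theorem by the extended continuous mapping theorem, and convergence in mean from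
uniformly bounded moments.

In the Hellinger statistic the terms with `q_x > 0` linearise. A term with `q_x = 0` is of the order
`√n` as long as the limit process has `Z_x ≠ 0`. If it has `Z_x = 0`, which happens with positive
probability because the slopes of a concave majorant may coincide, then the estimator itself is
eventually constant at `x` and the term vanishes. If some such `x` exists, the expectation of the
limit is infinite.
-/

namespace DiscreteMonotone

open scoped NNReal

noncomputable section

section ConvergenceInDistribution

theorem mem_of_tendsto_atTop_prod_nhds {E S : Type*} [TopologicalSpace E] [TopologicalSpace S]
    {g : ℕ → E → S} {e : E} {s : S} (hg : Tendsto (fun q : ℕ × E => g q.1 q.2) (atTop ×ˢ 𝓝 e) (𝓝 s))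
    {C : Set S} (hC : IsClosed C) (he : ∀ m, e ∈ closure {e' | ∃ n, m ≤ n ∧ g n e' ∈ C}) :
    s ∈ C := by
  by_contra hs
  obtain ⟨a, ha, b, hb, hab⟩ :=
    eventually_prod_iff.1 (hg.eventually (hC.isOpen_compl.mem_nhds hs))
  obtain ⟨m, hm⟩ := eventually_atTop.1 ha
  obtain ⟨e', ⟨n, hn, hmem⟩, he'⟩ :=
    ((mem_closure_iff_frequently.1 (he m)).and_eventually hb).exists
  exact hab (hm n hn) he' hmem

variable {Ω : ℕ → Type*} [∀ n, MeasurableSpace (Ω n)] {P : ∀ n, Measure (Ω n)}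
  [∀ n, IsProbabilityMeasure (P n)] {Ω' : Type*} [MeasurableSpace Ω'] {P' : Measure Ω'}
  [IsProbabilityMeasure P']

theorem tendstoInDistribution_of_tendsto_atTop_prod_nhds {E S : Type*}
    [TopologicalSpace E] [MeasurableSpace E] [OpensMeasurableSpace E] [HasOuterApproxClosed E]
    [TopologicalSpace S] [MeasurableSpace S] [OpensMeasurableSpace S]
    {Y : ∀ n, Ω n → E} {Y' : Ω' → E} (hY : TendstoInDistribution Y atTop Y' P P')
    {g : ℕ → E → S} {g' : E → S} (hg : ∀ n, AEMeasurable (fun ω => g n (Y n ω)) (P n))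
    (hg' : AEMeasurable (fun ω => g' (Y' ω)) P')
    (h : ∀ᵐ ω ∂P',
      Tendsto (fun q : ℕ × E => g q.1 q.2) (atTop ×ˢ 𝓝 (Y' ω)) (𝓝 (g' (Y' ω)))) :
    TendstoInDistribution (fun n ω => g n (Y n ω)) atTop (fun ω => g' (Y' ω)) P P' where
  forall_aemeasurable := hg
  aemeasurable_limit := hg'
  tendsto := by
    refine tendsto_of_forall_isClosed_limsup_le' fun C hC => ?_
    simp only [ProbabilityMeasure.coe_mk]
    set K : ℕ → Set E := fun m => closure {e | ∃ n, m ≤ n ∧ g n e ∈ C}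
    have isClosed_K : ∀ m, IsClosed (K m) := fun m => isClosed_closure
    have antitone_K : Antitone K := fun a b hab =>
      closure_mono fun e ⟨n, hn, he⟩ => ⟨n, hab.trans hn, he⟩
    have limsup_le : ∀ m, limsup (fun n => (P n).map (fun ω => g n (Y n ω)) C) atTop ≤
        P'.map Y' (K m) := by
      intro m
      have portmanteau :=
        ProbabilityMeasure.limsup_measure_closed_le_of_tendsto hY.tendsto (isClosed_K m)
      simp only [ProbabilityMeasure.coe_mk] at portmanteau
      refine le_trans (limsup_le_limsup ?_) portmanteau
      filter_upwards [eventually_ge_atTop m] with n hn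
      rw [Measure.map_apply_of_aemeasurable (hg n) hC.measurableSet,
        Measure.map_apply_of_aemeasurable (hY.forall_aemeasurable n) (isClosed_K m).measurableSet]
      exact measure_mono fun ω hω => subset_closure ⟨n, hn, hω⟩
    have tendsto_K : Tendsto (fun m => P'.map Y' (K m)) atTop (𝓝 (P'.map Y' (⋂ m, K m))) :=
      haveI := Measure.isProbabilityMeasure_map hY.aemeasurable_limit
      tendsto_measure_iInter_atTop (fun m => (isClosed_K m).measurableSet.nullMeasurableSet)
        antitone_K ⟨0, measure_ne_top _ _⟩
    refine (ge_of_tendsto' tendsto_K limsup_le).trans ?_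
    rw [Measure.map_apply_of_aemeasurable hg' hC.measurableSet,
      Measure.map_apply_of_aemeasurable hY.aemeasurable_limit
        (MeasurableSet.iInter fun m => (isClosed_K m).measurableSet)]
    refine measure_mono_ae ?_
    filter_upwards [h] with ω hω hmem
    exact mem_of_tendsto_atTop_prod_nhds hω hC (Set.mem_iInter.1 hmem)

theorem tendsto_lintegral_min {T : ∀ n, Ω n → ℝ≥0∞} {T' : Ω' → ℝ≥0∞}
    (hT : TendstoInDistribution T atTop T' P P') (M : ℕ) :
    Tendsto (fun n => ∫⁻ ω, min (T n ω) M ∂P n) atTop (𝓝 (∫⁻ ω, min (T' ω) M ∂P')) := by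
  have coe_toNNReal_min : ∀ t : ℝ≥0∞, ((min t M).toNNReal : ℝ≥0∞) = min t M := fun t =>
    ENNReal.coe_toNNReal (ne_top_of_le_ne_top (ENNReal.natCast_ne_top M) (min_le_right _ _))
  have continuous_toNNReal_min : Continuous fun t : ℝ≥0∞ => (min t M).toNNReal :=
    ENNReal.continuousOn_toNNReal.comp_continuous (by fun_prop) fun t =>
      ne_top_of_le_ne_top (ENNReal.natCast_ne_top M) (min_le_right _ _)
  have toNNReal_min_le : ∀ t : ℝ≥0∞, ((min t M).toNNReal : ℝ) ≤ M := fun t => by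
    exact_mod_cast ENNReal.coe_le_coe.1 ((coe_toNNReal_min t).trans_le (min_le_right _ _))
  have h := ProbabilityMeasure.tendsto_iff_forall_lintegral_tendsto.1 hT.tendsto
    (BoundedContinuousFunction.mkOfBound ⟨_, continuous_toNNReal_min⟩ M fun x y => by
      rw [NNReal.dist_eq]
      exact abs_sub_le_of_nonneg_of_le (NNReal.coe_nonneg _) (toNNReal_min_le x)
        (NNReal.coe_nonneg _) (toNNReal_min_le y))
  simp only [ProbabilityMeasure.coe_mk, BoundedContinuousFunction.mkOfBound_coe,
    ContinuousMap.coe_mk, coe_toNNReal_min] at h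
  rw [lintegral_map' (by fun_prop) hT.aemeasurable_limit] at h
  refine h.congr fun n => ?_
  rw [lintegral_map' (by fun_prop) (hT.forall_aemeasurable n)]

theorem lintegral_le_liminf_of_tendstoInDistribution {T : ∀ n, Ω n → ℝ≥0∞} {T' : Ω' → ℝ≥0∞}
    (hT : TendstoInDistribution T atTop T' P P') :
    ∫⁻ ω, T' ω ∂P' ≤ liminf (fun n => ∫⁻ ω, T n ω ∂P n) atTop := by
  have tendsto_min : Tendsto (fun M : ℕ => ∫⁻ ω, min (T' ω) M ∂P') atTop (𝓝 (∫⁻ ω, T' ω ∂P')) := by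
    refine lintegral_tendsto_of_tendsto_of_monotone
      (fun M => hT.aemeasurable_limit.min aemeasurable_const)
      (ae_of_all _ fun ω a b hab => min_le_min_left _ (by exact_mod_cast hab))
      (ae_of_all _ fun ω => ?_)
    simpa using (tendsto_const_nhds (x := T' ω)).min ENNReal.tendsto_nat_nhds_top
  refine le_of_tendsto' tendsto_min fun M => ?_
  rw [← (tendsto_lintegral_min hT M).liminf_eq]
  exact liminf_le_liminf (Eventually.of_forall fun n => lintegral_mono fun ω => min_le_left _ _)

theorem le_min_add_sq_mul_inv (t : ℝ≥0∞) (M : ℕ) :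
    t ≤ min t (M + 1 : ℕ) + t ^ 2 * ((M + 1 : ℕ) : ℝ≥0∞)⁻¹ := by
  rcases le_total t (M + 1 : ℕ) with h | h
  · rw [min_eq_left h]
    exact le_self_add
  · refine le_trans ?_ le_add_self
    rw [← div_eq_mul_inv, ENNReal.le_div_iff_mul_le (by simp) (by simp), sq]
    gcongr

theorem tendsto_lintegral_of_lintegral_sq_le {T : ∀ n, Ω n → ℝ≥0∞} {T' : Ω' → ℝ≥0∞}
    (hT : TendstoInDistribution T atTop T' P P') {C : ℝ≥0}
    (hC : ∀ n, ∫⁻ ω, T n ω ^ 2 ∂P n ≤ C) :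
    Tendsto (fun n => ∫⁻ ω, T n ω ∂P n) atTop (𝓝 (∫⁻ ω, T' ω ∂P')) := by
  refine tendsto_of_le_liminf_of_limsup_le (lintegral_le_liminf_of_tendstoInDistribution hT) ?_
  have limsup_le : ∀ M : ℕ, limsup (fun n => ∫⁻ ω, T n ω ∂P n) atTop ≤
      ∫⁻ ω, T' ω ∂P' + C * ((M + 1 : ℕ) : ℝ≥0∞)⁻¹ := by
    intro M
    have lintegral_le : ∀ n, ∫⁻ ω, T n ω ∂P n ≤
        ∫⁻ ω, min (T n ω) (M + 1 : ℕ) ∂P n + C * ((M + 1 : ℕ) : ℝ≥0∞)⁻¹ := by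
      intro n
      refine (lintegral_mono fun ω => le_min_add_sq_mul_inv (T n ω) M).trans ?_
      rw [lintegral_add_left' ((hT.forall_aemeasurable n).min aemeasurable_const),
        lintegral_mul_const'' _ ((hT.forall_aemeasurable n).pow_const 2)]
      gcongr
      exact hC n
    refine (limsup_le_limsup (Eventually.of_forall lintegral_le)).trans ?_
    rw [((tendsto_lintegral_min hT (M + 1)).add tendsto_const_nhds).limsup_eq]
    gcongr
    exact min_le_left _ _
  have tendsto_remainder : Tendsto (fun M : ℕ => ∫⁻ ω, T' ω ∂P' + C * ((M + 1 : ℕ) : ℝ≥0∞)⁻¹)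
      atTop (𝓝 (∫⁻ ω, T' ω ∂P' + C * 0)) :=
    tendsto_const_nhds.add (ENNReal.Tendsto.const_mul
      (ENNReal.tendsto_inv_nat_nhds_zero.comp (tendsto_add_atTop_nat 1))
      (Or.inr ENNReal.coe_ne_top))
  simpa using ge_of_tendsto' tendsto_remainder limsup_le

end ConvergenceInDistribution

section BoundedMoments

variable {Ω ι : Type*} [MeasurableSpace Ω] {P : Measure Ω}

/-- The family `T` is bounded in `L^q` for every finite exponent `q ≥ 1`. -/
def HasBoundedMoments (T : ι → Ω → ℝ) (P : Measure Ω) : Prop :=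
  ∀ q : ℝ≥0, 1 ≤ q → ∃ C : ℝ≥0, ∀ i, eLpNorm (T i) q P ≤ C

theorem HasBoundedMoments.of_abs_le {S T : ι → Ω → ℝ} (hT : HasBoundedMoments T P) {A : ℝ}
    (h : ∀ i, ∀ᵐ ω ∂P, |S i ω| ≤ A * |T i ω|) : HasBoundedMoments S P := by
  intro q hq
  obtain ⟨C, hC⟩ := hT q hq
  refine ⟨A.toNNReal * C, fun i => (eLpNorm_le_mul_eLpNorm_of_ae_le_mul
    (f := S i) (g := T i) (c := A) (h i) q).trans ?_⟩
  rw [ENNReal.coe_mul]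
  exact mul_le_mul_right (hC i) _

theorem HasBoundedMoments.sum_abs {α : Type*} {T : α → ι → Ω → ℝ} {s : Finset α}
    (hT : ∀ a ∈ s, HasBoundedMoments (T a) P) (hm : ∀ a ∈ s, ∀ i, AEStronglyMeasurable (T a i) P) :
    HasBoundedMoments (fun i ω => ∑ a ∈ s, |T a i ω|) P := by
  intro q hq
  choose! C hC using fun a ha => hT a ha q hq
  refine ⟨∑ a ∈ s, C a, fun i => ?_⟩
  have h := eLpNorm_sum_le (p := q) (f := fun a ω => |T a i ω|) (fun a ha => (hm a ha i).norm)
    (ENNReal.coe_le_coe.2 hq)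
  rw [Finset.sum_fn] at h
  refine h.trans ?_
  rw [ENNReal.ofNNReal_finsetSum]
  exact Finset.sum_le_sum fun a ha => (eLpNorm_norm (T a i)).trans_le (hC a ha i)

theorem HasBoundedMoments.abs_rpow {T : ι → Ω → ℝ} (hT : HasBoundedMoments T P) {s : ℝ}
    (hs : 1 ≤ s) : HasBoundedMoments (fun i ω => |T i ω| ^ s) P := by
  intro q hq
  obtain ⟨C, hC⟩ := hT (q * s.toNNReal) (one_le_mul hq (Real.one_le_toNNReal.2 hs))
  refine ⟨C ^ s, fun i => ?_⟩
  have h : eLpNorm (fun ω => |T i ω| ^ s) q P = eLpNorm (T i) (q * ENNReal.ofReal s) P ^ s :=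
    eLpNorm_norm_rpow (T i) (by positivity)
  rw [h, ENNReal.coe_rpow_of_nonneg _ (by positivity)]
  exact ENNReal.rpow_le_rpow (by simpa [ENNReal.ofReal] using hC i) (by positivity)

theorem HasBoundedMoments.lintegral_pow_le {T : ι → Ω → ℝ} (hT : HasBoundedMoments T P) {N : ℕ}
    (hN : 1 ≤ N) : ∃ C : ℝ≥0, ∀ i, ∫⁻ ω, ‖T i ω‖ₑ ^ N ∂P ≤ C := by
  obtain ⟨C, hC⟩ := hT N (by exact_mod_cast hN)
  refine ⟨C ^ N, fun i => ?_⟩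
  have h := eLpNorm_nnreal_pow_eq_lintegral (f := T i) (μ := P) (p := (N : ℝ≥0))
    (by exact_mod_cast (by omega : N ≠ 0))
  simp only [NNReal.coe_natCast, ENNReal.rpow_natCast] at h
  rw [← h, ENNReal.coe_pow]
  exact pow_le_pow_left' (hC i) N

theorem lintegral_enorm_pow_le_of_hasSubgaussianMGF {X : Ω → ℝ} {c : ℝ≥0}
    (hX : HasSubgaussianMGF X c P) (N : ℕ) :
    ∫⁻ ω, ‖X ω‖ₑ ^ N ∂P ≤ ENNReal.ofReal (N.factorial * (2 * Real.exp (c / 2))) := by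
  have pow_le_exp : ∀ x : ℝ, |x| ^ N ≤ N.factorial * (Real.exp x + Real.exp (-x)) := fun x =>
    ((div_le_iff₀' (by positivity)).1 (Real.pow_div_factorial_le_exp |x| (abs_nonneg x) N)).trans
      (by gcongr; exact Real.exp_abs_le x)
  have integrable_exp : Integrable (fun ω => Real.exp (X ω)) P := by
    simpa using hX.integrable_exp_mul 1
  have integrable_exp_neg : Integrable (fun ω => Real.exp (-X ω)) P := by
    simpa using hX.integrable_exp_mul (-1)
  have integral_exp_le : ∫ ω, Real.exp (X ω) ∂P ≤ Real.exp (c / 2) := by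
    simpa [mgf] using hX.mgf_le 1
  have integral_exp_neg_le : ∫ ω, Real.exp (-X ω) ∂P ≤ Real.exp (c / 2) := by
    simpa [mgf] using hX.mgf_le (-1)
  calc ∫⁻ ω, ‖X ω‖ₑ ^ N ∂P
      ≤ ∫⁻ ω, ENNReal.ofReal (N.factorial * (Real.exp (X ω) + Real.exp (-X ω))) ∂P := by
        refine lintegral_mono fun ω => ?_
        rw [Real.enorm_eq_ofReal_abs, ← ENNReal.ofReal_pow (abs_nonneg _)]
        exact ENNReal.ofReal_le_ofReal (pow_le_exp (X ω))
    _ = ENNReal.ofReal (∫ ω, N.factorial * (Real.exp (X ω) + Real.exp (-X ω)) ∂P) :=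
        (ofReal_integral_eq_lintegral_ofReal
          ((integrable_exp.add integrable_exp_neg).const_mul _)
          (ae_of_all _ fun ω => mul_nonneg (Nat.cast_nonneg _)
            (add_nonneg (Real.exp_nonneg _) (Real.exp_nonneg _)))).symm
    _ ≤ ENNReal.ofReal (N.factorial * (2 * Real.exp (c / 2))) := by
        rw [integral_const_mul, integral_add integrable_exp integrable_exp_neg]
        gcongr
        linarith

theorem hasBoundedMoments_of_hasSubgaussianMGF [IsProbabilityMeasure P] {T : ι → Ω → ℝ} {c : ℝ≥0}
    (hT : ∀ i, HasSubgaussianMGF (T i) c P) : HasBoundedMoments T P := by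
  intro q hq
  set N : ℕ := ⌈q⌉₊
  have hN : N ≠ 0 := (Nat.ceil_pos.2 (zero_lt_one.trans_le hq)).ne'
  refine ⟨(N.factorial * (2 * Real.exp (c / 2))).toNNReal ^ (N : ℝ)⁻¹, fun i => ?_⟩
  calc eLpNorm (T i) q P
      ≤ eLpNorm (T i) (N : ℝ≥0) P :=
        eLpNorm_le_eLpNorm_of_exponent_le (ENNReal.coe_le_coe.2 (Nat.le_ceil q))
          (hT i).aestronglyMeasurable
    _ = (∫⁻ ω, ‖T i ω‖ₑ ^ N ∂P) ^ (N : ℝ)⁻¹ := by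
        rw [eLpNorm_nnreal_eq_lintegral (by exact_mod_cast hN)]
        simp
    _ ≤ _ := by
        rw [ENNReal.coe_rpow_of_nonneg _ (inv_nonneg.2 N.cast_nonneg)]
        exact ENNReal.rpow_le_rpow (lintegral_enorm_pow_le_of_hasSubgaussianMGF (hT i) N)
          (inv_nonneg.2 N.cast_nonneg)

variable [IsProbabilityMeasure P] {Ω' : Type*} [MeasurableSpace Ω'] {P' : Measure Ω'}
  [IsProbabilityMeasure P']

theorem HasBoundedMoments.convergesInLawAndMean {T : ℕ → Ω → ℝ} {T' : Ω' → ℝ}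
    (hb : HasBoundedMoments T P) (hT : TendstoInDistribution T atTop T' (fun _ => P) P')
    (h0 : ∀ n ω, 0 ≤ T n ω) (h0' : ∀ ω, 0 ≤ T' ω) : ConvergesInLawAndMean T T' P P' := by
  have tendsto_ofReal : TendstoInDistribution (fun n ω => ENNReal.ofReal (T n ω)) atTop
      (fun ω => ENNReal.ofReal (T' ω)) (fun _ => P) P' :=
    TendstoInDistribution.continuous_comp (g := ENNReal.ofReal) ENNReal.continuous_ofReal hT
  have tendsto_lintegral : Tendsto (fun n => ∫⁻ ω, ENNReal.ofReal (T n ω) ∂P) atTop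
      (𝓝 (∫⁻ ω, ENNReal.ofReal (T' ω) ∂P')) := by
    obtain ⟨C, hC⟩ := hb.lintegral_pow_le one_le_two
    refine tendsto_lintegral_of_lintegral_sq_le tendsto_ofReal (C := C) fun n => ?_
    simpa only [Real.enorm_eq_ofReal (h0 n _)] using hC n
  obtain ⟨C, hC⟩ := hb.lintegral_pow_le le_rfl
  simp only [pow_one, Real.enorm_eq_ofReal (h0 _ _)] at hC
  have limit_ne_top : ∫⁻ ω, ENNReal.ofReal (T' ω) ∂P' ≠ ⊤ :=
    ne_top_of_le_ne_top ENNReal.coe_ne_top (le_of_tendsto' tendsto_lintegral hC)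
  refine ⟨hT, fun n => (lintegral_ofReal_ne_top_iff_integrable
    (hT.forall_aemeasurable n).aestronglyMeasurable (ae_of_all _ (h0 n))).1
      (ne_top_of_le_ne_top ENNReal.coe_ne_top (hC n)), (lintegral_ofReal_ne_top_iff_integrable
    hT.aemeasurable_limit.aestronglyMeasurable (ae_of_all _ h0')).1 limit_ne_top, ?_⟩
  rw [integral_eq_lintegral_of_nonneg_ae (ae_of_all _ h0')
    hT.aemeasurable_limit.aestronglyMeasurable]
  refine ((ENNReal.tendsto_toReal limit_ne_top).comp tendsto_lintegral).congr fun n => ?_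
  rw [integral_eq_lintegral_of_nonneg_ae (ae_of_all _ (h0 n))
    (hT.forall_aemeasurable n).aestronglyMeasurable, Function.comp_apply]

end BoundedMoments

section MassFunction

variable {p : ℕ → ℝ}

theorem IsDecreasingPMF.pos_iff_le_supportEnd (hp : IsDecreasingPMF p)
    (hκ : BddAbove {x | 0 < p x}) {x : ℕ} : 0 < p x ↔ x ≤ supportEnd p := by
  refine ⟨fun h => le_csSup hκ h, fun h => ?_⟩
  have support_nonempty : {x | 0 < p x}.Nonempty := by
    by_contra hne
    have p_eq_zero : p = fun _ => 0 := funext fun y =>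
      le_antisymm (not_lt.1 fun hy => hne ⟨y, hy⟩) (hp.nonneg y)
    exact zero_ne_one (hasSum_zero.unique (p_eq_zero ▸ hp.hasSum))
  have pos_supportEnd : 0 < p (supportEnd p) := Nat.sSup_mem support_nonempty hκ
  exact pos_supportEnd.trans_le (hp.antitone h)

theorem IsDecreasingPMF.eq_zero_of_supportEnd_lt (hp : IsDecreasingPMF p)
    (hκ : BddAbove {x | 0 < p x}) {x : ℕ} (hx : supportEnd p < x) : p x = 0 :=
  le_antisymm (not_lt.1 fun h => ((hp.pos_iff_le_supportEnd hκ).1 h).not_gt hx) (hp.nonneg x)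

end MassFunction

section Mixing

theorem continuous_mixing : Continuous mixing := by
  refine continuous_pi fun x => ?_
  unfold mixing
  fun_prop

theorem mixing_eq_zero_iff {w : ℕ → ℝ} {x : ℕ} : mixing w x = 0 ↔ w (x + 1) = w x := by
  have : (x : ℝ) + 1 ≠ 0 := by positivity
  rw [mixing, mul_eq_zero, neg_eq_zero, or_iff_right this, sub_eq_zero]

theorem mixing_eq_zero_of_le {w : ℕ → ℝ} {m : ℕ} (hw : ∀ x, m ≤ x → w x = 0) {x : ℕ}
    (hx : m ≤ x) : mixing w x = 0 :=
  mixing_eq_zero_iff.2 ((hw _ (hx.trans (Nat.le_succ x))).trans (hw _ hx).symm)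

theorem mixing_nonneg {w : ℕ → ℝ} (hw : Antitone w) (x : ℕ) : 0 ≤ mixing w x := by
  rw [mixing, neg_mul, ← mul_neg, neg_sub]
  exact mul_nonneg (by positivity) (sub_nonneg.2 (hw (Nat.le_succ x)))

theorem abs_mixing_le {w : ℕ → ℝ} {B : ℝ} (hw : ∀ x, |w x| ≤ B) (x : ℕ) :
    |mixing w x| ≤ 2 * ((x : ℝ) + 1) * B := by
  rw [mixing, abs_mul, abs_neg, abs_of_nonneg (by positivity : (0 : ℝ) ≤ (x : ℝ) + 1)]
  calc ((x : ℝ) + 1) * |w (x + 1) - w x|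
      ≤ ((x : ℝ) + 1) * (|w (x + 1)| + |w x|) := by gcongr; exact abs_sub _ _
    _ ≤ ((x : ℝ) + 1) * (B + B) := by gcongr <;> exact hw _
    _ = 2 * ((x : ℝ) + 1) * B := by ring

theorem mixingFluctuation_eq {Ω : Type*} (p : ℕ → ℝ) (phat : ℕ → Ω → ℕ → ℝ) (n : ℕ) (ω : Ω) :
    mixingFluctuation p phat n ω = mixing fun x => √(n : ℝ) * (phat n ω x - p x) := by
  funext x
  simp only [mixingFluctuation, mixing]
  ring

end Mixing

section GaussianLimit

variable {Ω : Type*} [MeasurableSpace Ω] {P : Measure Ω} {p : ℕ → ℝ}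

/-- The quadratic form of the covariance matrix `p_x δ_{x,x'} - p_x p_{x'}`, which is that of the
indicators of the points `x ∈ s` under the law `p`. -/
def covarianceForm (p : ℕ → ℝ) (s : Finset ℕ) (c : ℕ → ℝ) : ℝ :=
  ∑ x ∈ s, ∑ x' ∈ s, c x * c x' * ((if x = x' then p x else 0) - p x * p x')

theorem covarianceForm_eq (p : ℕ → ℝ) (s : Finset ℕ) (c : ℕ → ℝ) :
    covarianceForm p s c = ∑ x ∈ s, c x ^ 2 * p x - (∑ x ∈ s, c x * p x) ^ 2 := by
  simp only [covarianceForm, mul_sub, Finset.sum_sub_distrib, mul_ite, mul_zero]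
  congr 1
  · refine Finset.sum_congr rfl fun x hx => ?_
    rw [Finset.sum_ite_eq, if_pos hx, sq]
  · rw [sq, Finset.sum_mul_sum]
    refine Finset.sum_congr rfl fun x _ => Finset.sum_congr rfl fun x' _ => ?_
    ring

theorem variance_sum_mul_eq_covarianceForm [IsProbabilityMeasure P] {ξ : ℕ → Ω → ℝ}
    (hξ : ∀ x, MemLp (ξ x) 2 P)
    (hcov : ∀ x x', covariance (ξ x) (ξ x') P = (if x = x' then p x else 0) - p x * p x')
    (s : Finset ℕ) (c : ℕ → ℝ) :
    variance (fun ω => ∑ x ∈ s, c x * ξ x ω) P = covarianceForm p s c := by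
  rw [variance_fun_sum' fun x _ => (hξ x).const_mul (c x)]
  refine Finset.sum_congr rfl fun x _ => Finset.sum_congr rfl fun x' _ => ?_
  rw [covariance_const_mul_left, covariance_const_mul_right, hcov]
  ring

namespace IsLimitGaussian

variable {Y : ℕ → Ω → ℝ} (hY : IsLimitGaussian p Y P)
include hY

theorem memLp_two (x : ℕ) : MemLp (Y x) 2 P :=
  (hY.gaussian.hasGaussianLaw_eval x).memLp_two

variable [IsProbabilityMeasure P]

theorem hasLaw_sum_mul (s : Finset ℕ) (c : ℕ → ℝ) :
    HasLaw (fun ω => ∑ x ∈ s, c x * Y x ω)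
      (gaussianReal 0 (covarianceForm p s c).toNNReal) P := by
  have hg : HasGaussianLaw (fun ω => ∑ x ∈ s, c x * Y x ω) P := by
    simpa using (hY.gaussian.smul c).hasGaussianLaw_fun_sum (I := s)
  refine ⟨hg.aemeasurable, ?_⟩
  rw [hg.map_eq_gaussianReal, variance_sum_mul_eq_covarianceForm hY.memLp_two hY.cov,
    integral_finsetSum _ fun x _ => ((hY.memLp_two x).integrable one_le_two).const_mul _]
  simp [integral_const_mul, hY.mean]

theorem ae_sum_mul_ne_zero {s : Finset ℕ} {c : ℕ → ℝ} (h : 0 < covarianceForm p s c) :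
    ∀ᵐ ω ∂P, ∑ x ∈ s, c x * Y x ω ≠ 0 := by
  have hlaw := hY.hasLaw_sum_mul s c
  have : NullSingletonClass (gaussianReal 0 (covarianceForm p s c).toNNReal) :=
    nullSingletonClass_gaussianReal (by simpa using h)
  have ae_ne_zero : ∀ᵐ y ∂(P.map fun ω => ∑ x ∈ s, c x * Y x ω), y ≠ 0 := by
    rw [hlaw.map_eq]
    exact ae_iff.2 (by simp [Set.ofPred_eq_eq_singleton])
  exact ae_of_ae_map hlaw.aemeasurable ae_ne_zero

theorem ae_eq_zero {x : ℕ} (hx : p x = 0) : ∀ᵐ ω ∂P, Y x ω = 0 := by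
  have variance_eq_zero : variance (Y x) P = 0 := by
    rw [← covariance_self (hY.gaussian.aemeasurable x), hY.cov]
    simp [hx]
  filter_upwards [ae_eq_integral_of_variance_eq_zero (hY.memLp_two x) variance_eq_zero] with ω hω
  rw [hω, hY.mean]

theorem ae_eq_zero_of_supportEnd_lt (hp : IsDecreasingPMF p) (hκ : BddAbove {x | 0 < p x}) :
    ∀ᵐ ω ∂P, ∀ x, supportEnd p < x → Y x ω = 0 := by
  refine ae_all_iff.2 fun x => ?_
  by_cases hx : supportEnd p < x
  · exact (hY.ae_eq_zero (hp.eq_zero_of_supportEnd_lt hκ hx)).mono fun ω hω _ => hω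
  · exact ae_of_all _ fun ω h => absurd h hx

end IsLimitGaussian

end GaussianLimit

section CramerWold

variable {Ω : ℕ → Type*} [∀ n, MeasurableSpace (Ω n)]
  {P : ∀ n, Measure (Ω n)} [∀ n, IsProbabilityMeasure (P n)] {Ω' : Type*} [MeasurableSpace Ω']
  {P' : Measure Ω'} [IsProbabilityMeasure P'] {ι : Type*} [Fintype ι]

theorem charFun_map_toLp {Ω : Type*} [MeasurableSpace Ω] {P : Measure Ω} {X : Ω → ι → ℝ}
    (hX : AEMeasurable X P) (t : EuclideanSpace ℝ ι) :
    charFun (P.map fun ω => WithLp.toLp 2 (X ω)) t =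
      charFun (P.map fun ω => ∑ i, t i * X ω i) 1 := by
  have aemeasurable_toLp : AEMeasurable (fun ω => WithLp.toLp 2 (X ω)) P :=
    (PiLp.continuous_toLp 2 _).measurable.comp_aemeasurable hX
  have aemeasurable_sum : AEMeasurable (fun ω => ∑ i, t i * X ω i) P :=
    Finset.aemeasurable_fun_sum _ fun i _ => (aemeasurable_pi_iff.1 hX i).const_mul _
  rw [charFun_apply, charFun_apply_real, integral_map aemeasurable_toLp (by fun_prop),
    integral_map aemeasurable_sum (by fun_prop)]
  simp [PiLp.inner_apply]

/-- The **Cramér–Wold device**. -/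
theorem tendstoInDistribution_of_forall_sum_mul {X : ∀ n, Ω n → ι → ℝ} {X' : Ω' → ι → ℝ}
    (h : ∀ c : ι → ℝ, TendstoInDistribution (fun n ω => ∑ i, c i * X n ω i) atTop
      (fun ω => ∑ i, c i * X' ω i) P P') :
    TendstoInDistribution X atTop X' P P' := by
  classical
  have hX : ∀ n, AEMeasurable (X n) (P n) := fun n => aemeasurable_pi_iff.2 fun i => by
    simpa [Pi.single_apply] using (h (Pi.single i 1)).forall_aemeasurable n
  have hX' : AEMeasurable X' P' := aemeasurable_pi_iff.2 fun i => by
    simpa [Pi.single_apply] using (h (Pi.single i 1)).aemeasurable_limit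
  have measurable_toLp := (PiLp.continuous_toLp 2 fun _ : ι => ℝ).measurable
  have tendsto_toLp : TendstoInDistribution (fun n ω => WithLp.toLp 2 (X n ω)) atTop
      (fun ω => WithLp.toLp 2 (X' ω)) P P' := by
    refine ⟨fun n => measurable_toLp.comp_aemeasurable (hX n),
      measurable_toLp.comp_aemeasurable hX',
      ProbabilityMeasure.tendsto_iff_tendsto_charFun.2 fun t => ?_⟩
    simp only [ProbabilityMeasure.coe_mk, charFun_map_toLp (hX _), charFun_map_toLp hX']
    exact ProbabilityMeasure.tendsto_iff_tendsto_charFun.1 (h t.ofLp).tendsto 1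
  exact tendsto_toLp.continuous_comp (PiLp.continuous_ofLp 2 _)

end CramerWold

section EmpiricalFluctuation

variable {Ω : Type*}

/-- The process `√n (p̂_n - p)`. -/
def empiricalFluctuation (p : ℕ → ℝ) (X : ℕ → Ω → ℕ) (n : ℕ) (ω : Ω) : ℕ → ℝ :=
  fun x => √(n : ℝ) * (empirical X n ω x - p x)

/-- The indicator of the event `ξ = x`, whose averages over a sample are the empirical
frequencies. -/
def hit (ξ : Ω → ℕ) (x : ℕ) (ω : Ω) : ℝ := if ξ ω = x then 1 else 0

theorem hit_mem_Icc (ξ : Ω → ℕ) (x : ℕ) (ω : Ω) : hit ξ x ω ∈ Set.Icc (0 : ℝ) 1 := by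
  unfold hit
  split_ifs <;> simp

theorem empirical_nonneg (X : ℕ → Ω → ℕ) (n : ℕ) (ω : Ω) (x : ℕ) : 0 ≤ empirical X n ω x :=
  mul_nonneg (by positivity) (Finset.sum_nonneg fun i _ => (hit_mem_Icc (X i) x ω).1)

theorem empirical_eq_zero {X : ℕ → Ω → ℕ} {n : ℕ} {ω : Ω} {x : ℕ} (h : ∀ i < n, X i ω ≠ x) :
    empirical X n ω x = 0 := by
  rw [empirical, Finset.sum_eq_zero fun i hi => if_neg (h i (Finset.mem_range.1 hi)), mul_zero]

theorem empiricalFluctuation_eq (p : ℕ → ℝ) (X : ℕ → Ω → ℕ) (n : ℕ) (ω : Ω) (x : ℕ) :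
    empiricalFluctuation p X n ω x =
      (√(n : ℝ))⁻¹ * ∑ i ∈ Finset.range n, (hit (X i) x ω - p x) := by
  rcases Nat.eq_zero_or_pos n with rfl | hn
  · simp [empiricalFluctuation]
  change √(n : ℝ) * ((n : ℝ)⁻¹ * ∑ i ∈ Finset.range n, hit (X i) x ω - p x) = _
  rw [Finset.sum_sub_distrib, Finset.sum_const, Finset.card_range, nsmul_eq_mul]
  have cast_pos : (0 : ℝ) < n := by exact_mod_cast hn
  field_simp
  rw [Real.sq_sqrt cast_pos.le]

variable [MeasurableSpace Ω] {P : Measure Ω}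

theorem measurable_hit {ξ : Ω → ℕ} (hξ : Measurable ξ) (x : ℕ) : Measurable (hit ξ x) :=
  (measurable_of_countable (fun k : ℕ => if k = x then (1 : ℝ) else 0)).comp hξ

theorem integral_hit {ξ : Ω → ℕ} (hξ : Measurable ξ) (x : ℕ) :
    ∫ ω, hit ξ x ω ∂P = P.real {ω | ξ ω = x} := by
  have hit_eq_indicator : hit ξ x = {ω | ξ ω = x}.indicator 1 := by
    funext ω
    simp [hit, Set.indicator_apply]
  have measurableSet_eq : MeasurableSet {ω | ξ ω = x} := hξ (measurableSet_singleton x)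
  rw [hit_eq_indicator, integral_indicator_one measurableSet_eq]

theorem memLp_hit [IsFiniteMeasure P] {ξ : Ω → ℕ} (hξ : Measurable ξ) (x : ℕ) :
    MemLp (hit ξ x) 2 P :=
  MemLp.of_bound (measurable_hit hξ x).aestronglyMeasurable 1 (ae_of_all _ fun ω =>
    (Real.norm_of_nonneg (hit_mem_Icc ξ x ω).1).trans_le (hit_mem_Icc ξ x ω).2)

theorem covariance_hit [IsProbabilityMeasure P] {ξ : Ω → ℕ} (hξ : Measurable ξ) (x x' : ℕ) :
    covariance (hit ξ x) (hit ξ x') P = (if x = x' then P.real {ω | ξ ω = x} else 0) -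
      P.real {ω | ξ ω = x} * P.real {ω | ξ ω = x'} := by
  rw [covariance_eq_sub (memLp_hit hξ x) (memLp_hit hξ x'), integral_hit hξ, integral_hit hξ]
  congr 1
  split_ifs with h
  · subst h
    rw [← integral_hit hξ]
    congr 1
    funext ω
    simp only [Pi.mul_apply, hit]
    split_ifs <;> simp
  · rw [← integral_zero Ω ℝ (μ := P)]
    congr 1
    funext ω
    simp only [Pi.mul_apply, hit]
    split_ifs <;> simp_all

/-- `X_0, X_1, …` are independent with common mass function `p`. -/
structure IsSample (p : ℕ → ℝ) (X : ℕ → Ω → ℕ) (P : Measure Ω) : Prop where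
  measurable : ∀ i, Measurable (X i)
  indep : iIndepFun X P
  law : ∀ i x, P.real {ω | X i ω = x} = p x

namespace IsSample

variable {p : ℕ → ℝ} {X : ℕ → Ω → ℕ} (hX : IsSample p X P)
include hX

variable [IsProbabilityMeasure P]

theorem ae_le_supportEnd (hp : IsDecreasingPMF p) (hκ : BddAbove {x | 0 < p x}) :
    ∀ᵐ ω ∂P, ∀ i, X i ω ≤ supportEnd p := by
  have ae_ne : ∀ᵐ ω ∂P, ∀ i, ∀ x ∈ Set.Ioi (supportEnd p), X i ω ≠ x := by
    refine ae_all_iff.2 fun i => (ae_ball_iff (Set.to_countable _)).2 fun x hx => ?_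
    have h := hX.law i x
    rw [hp.eq_zero_of_supportEnd_lt hκ hx, measureReal_eq_zero_iff] at h
    simpa [ae_iff] using h
  filter_upwards [ae_ne] with ω hω i
  exact not_lt.1 fun hlt => hω i _ hlt rfl

theorem identDistrib (i j : ℕ) : IdentDistrib (X i) (X j) P P := by
  refine ⟨(hX.measurable i).aemeasurable, (hX.measurable j).aemeasurable,
    Measure.ext_of_singleton fun x => ?_⟩
  rw [Measure.map_apply (hX.measurable i) (measurableSet_singleton x),
    Measure.map_apply (hX.measurable j) (measurableSet_singleton x)]
  exact (measureReal_eq_measureReal_iff).1 ((hX.law i x).trans (hX.law j x).symm)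

variable {Ω' : Type*} [MeasurableSpace Ω'] {P' : Measure Ω'} [IsProbabilityMeasure P']
  {Y : ℕ → Ω' → ℝ}

theorem tendstoInDistribution_sum_mul_empiricalFluctuation (hY : IsLimitGaussian p Y P')
    (s : Finset ℕ) (c : ℕ → ℝ) :
    TendstoInDistribution (fun n ω => ∑ x ∈ s, c x * empiricalFluctuation p X n ω x) atTop
      (fun ω => ∑ x ∈ s, c x * Y x ω) (fun _ => P) P' := by
  set g : ℕ → ℝ := fun k => ∑ x ∈ s, c x * if k = x then (1 : ℝ) else 0
  have measurable_g : Measurable g := measurable_of_countable g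
  have g_comp : ∀ i, (fun ω => g (X i ω)) = fun ω => ∑ x ∈ s, c x * hit (X i) x ω := fun i => rfl
  have memLp_g : MemLp (fun ω => g (X 0 ω)) 2 P :=
    memLp_finsetSum _ fun x _ => (memLp_hit (hX.measurable 0) x).const_mul _
  have variance_g : variance (fun ω => g (X 0 ω)) P = covarianceForm p s c := by
    refine variance_sum_mul_eq_covarianceForm (memLp_hit (hX.measurable 0)) (fun x x' => ?_) s c
    simp only [covariance_hit (hX.measurable 0), hX.law]
  have integral_g : ∫ ω, g (X 0 ω) ∂P = ∑ x ∈ s, c x * p x := by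
    rw [g_comp, integral_finsetSum _ fun x _ =>
      ((memLp_hit (P := P) (hX.measurable 0) x).integrable one_le_two).const_mul _]
    simp only [integral_const_mul, integral_hit (hX.measurable 0), hX.law]
  have clt := tendstoInDistribution_inv_sqrt_mul_sum_sub (X := fun i ω => g (X i ω))
    (variance_g ▸ hY.hasLaw_sum_mul s c) memLp_g (hX.indep.comp (fun _ => g) fun _ => measurable_g)
    (fun i => (hX.identDistrib i 0).comp measurable_g)
  convert! clt using 3 with n ω
  rw [integral_g]
  simp only [empiricalFluctuation_eq, Finset.sum_sub_distrib, Finset.sum_const, Finset.card_range,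
    nsmul_eq_mul, g, hit]
  rw [Finset.sum_comm (s := Finset.range n), Finset.mul_sum, ← Finset.sum_sub_distrib,
    Finset.mul_sum]
  refine Finset.sum_congr rfl fun x _ => ?_
  rw [← Finset.mul_sum]
  ring

theorem tendstoInDistribution_empiricalFluctuation (hp : IsDecreasingPMF p)
    (hκ : BddAbove {x | 0 < p x}) (hY : IsLimitGaussian p Y P') :
    TendstoInDistribution (empiricalFluctuation p X) atTop (fun ω x => Y x ω) (fun _ => P) P' := by
  set m := supportEnd p + 1
  have finite_dimensional : TendstoInDistribution
      (fun n ω (i : Fin m) => empiricalFluctuation p X n ω i) atTop (fun ω i => Y i ω)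
      (fun _ => P) P' := by
    refine tendstoInDistribution_of_forall_sum_mul fun c => ?_
    convert! hX.tendstoInDistribution_sum_mul_empiricalFluctuation hY (Finset.range m)
      (fun x => if h : x < m then c ⟨x, h⟩ else 0) using 1 <;>
    · funext
      simp [Finset.sum_range]
  let extend : (Fin m → ℝ) → ℕ → ℝ := fun v x => if h : x < m then v ⟨x, h⟩ else 0
  have continuous_extend : Continuous extend := continuous_pi fun x => by
    by_cases h : x < m <;> simp only [extend, h, dite_true, dite_false] <;> fun_prop
  have extend_eq : ∀ w : ℕ → ℝ, (∀ x, supportEnd p < x → w x = 0) →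
      extend (fun i => w i) = w := fun w hw => funext fun x => by
    by_cases h : x < m
    · exact dif_pos h
    · exact (dif_neg h).trans (hw x (by omega)).symm
  refine (finite_dimensional.continuous_comp continuous_extend).congr (fun n => ?_) ?_
  · filter_upwards [hX.ae_le_supportEnd hp hκ] with ω hω
    refine extend_eq _ fun x hx => ?_
    rw [empiricalFluctuation, empirical_eq_zero fun i _ => ((hω i).trans_lt hx).ne,
      hp.eq_zero_of_supportEnd_lt hκ hx, sub_zero, mul_zero]
  · filter_upwards [hY.ae_eq_zero_of_supportEnd_lt hp hκ] with ω hω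
    exact extend_eq _ hω

theorem hasSubgaussianMGF_empiricalFluctuation (n x : ℕ) :
    HasSubgaussianMGF (fun ω => empiricalFluctuation p X n ω x) 1 P := by
  have hasSubgaussianMGF_hit : ∀ i, HasSubgaussianMGF (fun ω => hit (X i) x ω - p x)
      ((‖(1 : ℝ) - 0‖₊ / 2) ^ 2) P := fun i => by
    rw [← hX.law i x, ← integral_hit (hX.measurable i)]
    exact hasSubgaussianMGF_of_mem_Icc (measurable_hit (hX.measurable i) x).aemeasurable
      (ae_of_all _ (hit_mem_Icc (X i) x))
  have indep_hit : iIndepFun (fun i ω => hit (X i) x ω - p x) P :=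
    hX.indep.comp (fun _ k => (if k = x then (1 : ℝ) else 0) - p x)
      fun _ => measurable_of_countable _
  have h := (HasSubgaussianMGF.sum_of_iIndepFun indep_hit (s := Finset.range n) fun i _ =>
    hasSubgaussianMGF_hit i).const_mul (√(n : ℝ))⁻¹
  simp only [empiricalFluctuation_eq]
  have parameter_le : ((√(n : ℝ))⁻¹) ^ 2 * (n * (1 / 2) ^ 2) ≤ 1 := by
    rw [inv_pow, Real.sq_sqrt n.cast_nonneg, ← mul_assoc]
    exact (mul_le_of_le_one_left (by norm_num) (inv_mul_le_one_of_le₀ le_rfl n.cast_nonneg)).trans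
      (by norm_num)
  refine ⟨h.integrable_exp_mul, fun t => (h.mgf_le t).trans (Real.exp_le_exp.2 ?_)⟩
  gcongr
  change (√(n : ℝ))⁻¹ ^ 2 * ((∑ i ∈ Finset.range n, (‖(1 : ℝ) - 0‖₊ / 2) ^ 2 : ℝ≥0) : ℝ) ≤ 1
  simpa using parameter_le

theorem hasBoundedMoments_sum_abs_empiricalFluctuation (s : Finset ℕ) :
    HasBoundedMoments (fun n ω => ∑ x ∈ s, |empiricalFluctuation p X n ω x|) P :=
  HasBoundedMoments.sum_abs (T := fun x n ω => empiricalFluctuation p X n ω x)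
    (fun x _ => hasBoundedMoments_of_hasSubgaussianMGF fun n =>
      hX.hasSubgaussianMGF_empiricalFluctuation n x)
    fun x _ n => (hX.hasSubgaussianMGF_empiricalFluctuation n x).aestronglyMeasurable

end IsSample

end EmpiricalFluctuation

section Vectors

/-- The first `m` entries of `u` followed by the entries of `v`. -/
def juxtapose (m : ℕ) (u v : ℕ → ℝ) : ℕ → ℝ := fun x => if x < m then u x else v (x - m)

variable {m : ℕ} {u v : ℕ → ℝ}

theorem juxtapose_of_lt {x : ℕ} (hx : x < m) : juxtapose m u v x = u x := if_pos hx

theorem juxtapose_add (x : ℕ) : juxtapose m u v (m + x) = v x := by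
  rw [juxtapose, if_neg (by omega), Nat.add_sub_cancel_left]

theorem sum_range_juxtapose {k : ℕ} (hk : k ≤ m) (f : ℝ → ℝ) :
    ∑ i ∈ Finset.range k, f (juxtapose m u v i) = ∑ i ∈ Finset.range k, f (u i) :=
  Finset.sum_congr rfl fun i hi => by rw [juxtapose_of_lt ((Finset.mem_range.1 hi).trans_le hk)]

theorem sum_range_add_juxtapose (k : ℕ) (f : ℝ → ℝ) :
    ∑ i ∈ Finset.range (m + k), f (juxtapose m u v i) =
      ∑ i ∈ Finset.range m, f (u i) + ∑ i ∈ Finset.range k, f (v i) := by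
  rw [Finset.sum_range_add, sum_range_juxtapose le_rfl]
  simp only [juxtapose_add]

theorem abs_le_sum_range (w : ℕ → ℝ) {x : ℕ} (hx : x < m) :
    |w x| ≤ ∑ i ∈ Finset.range m, |w i| :=
  Finset.single_le_sum (f := fun i => |w i|) (fun _ _ => abs_nonneg _) (Finset.mem_range.2 hx)

/-- No two disjoint nonempty sets of entries of the vector `(w 0, …, w (m - 1))` have the same
average (the denominators being cleared). This is the genericity condition under which `rear` and
`gren` are locally simple. -/
def HasDistinctAverages (m : ℕ) (w : ℕ → ℝ) : Prop :=
  ∀ s ⊆ Finset.range m, ∀ t ⊆ Finset.range m, Disjoint s t → s.Nonempty → t.Nonempty →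
    (t.card : ℝ) * ∑ i ∈ s, w i ≠ s.card * ∑ i ∈ t, w i

theorem HasDistinctAverages.ne {w : ℕ → ℝ} (hw : HasDistinctAverages m w) {i j : ℕ} (hi : i < m)
    (hj : j < m) (hij : i ≠ j) : w i ≠ w j := by
  simpa using hw {i} (by simpa using hi) {j} (by simpa using hj) (by simpa using hij)
    (Finset.singleton_nonempty i) (Finset.singleton_nonempty j)

end Vectors

section Rearrangement

/-- `s` is the decreasing rearrangement of `w` on `{0, …, m - 1}`, equality of the two multisets
of entries being tested by sums of arbitrary functions. -/
structure IsRear (m : ℕ) (w s : ℕ → ℝ) : Prop where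
  antitone : ∀ i j, i ≤ j → j < m → s j ≤ s i
  sum_comp : ∀ f : ℝ → ℝ, ∑ i ∈ Finset.range m, f (s i) = ∑ i ∈ Finset.range m, f (w i)

theorem isRear_rear (m : ℕ) (w : ℕ → ℝ) : IsRear m w (rear m w) where
  antitone i j hij hj := by
    have hi : i < m := hij.trans_lt hj
    have neg_le_neg := Tuple.monotone_sort (fun i : Fin m => -w i)
      (show (⟨i, hi⟩ : Fin m) ≤ ⟨j, hj⟩ from hij)
    simpa [rear, hi, hj] using neg_le_neg
  sum_comp f := by
    rw [← Fin.sum_univ_eq_sum_range (fun i => f (rear m w i)),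
      ← Fin.sum_univ_eq_sum_range (fun i => f (w i)),
      ← Equiv.sum_comp (Tuple.sort fun i : Fin m => -w i) (fun i : Fin m => f (w i))]
    refine Finset.sum_congr rfl fun i _ => ?_
    simp [rear]

theorem rear_of_le {m : ℕ} {w : ℕ → ℝ} {x : ℕ} (h : m ≤ x) : rear m w x = 0 := by
  simp [rear, h.not_gt]

theorem exists_rear_eq {m x : ℕ} (w : ℕ → ℝ) (hx : x < m) : ∃ i < m, rear m w x = w i := by
  rw [rear, dif_pos hx]
  exact ⟨_, Fin.isLt _, rfl⟩

theorem HasDistinctAverages.rear_ne {m : ℕ} {w : ℕ → ℝ} (hw : HasDistinctAverages m w) {i j : ℕ}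
    (hi : i < m) (hj : j < m) (hij : i ≠ j) : rear m w i ≠ rear m w j := by
  rw [rear, dif_pos hi, rear, dif_pos hj]
  refine hw.ne (Fin.isLt _) (Fin.isLt _) fun h => hij ?_
  simpa using (Tuple.sort fun i : Fin m => -w i).injective (Fin.ext h)

namespace IsRear

variable {m n : ℕ} {w w' s s' t : ℕ → ℝ}

theorem card_filter_le (h : IsRear m w s) (t : ℝ) :
    ((Finset.range m).filter fun i => t ≤ s i).card =
      ((Finset.range m).filter fun i => t ≤ w i).card := by
  have sum_indicator_eq := h.sum_comp fun y => if t ≤ y then 1 else 0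
  simp only [Finset.sum_boole] at sum_indicator_eq
  exact_mod_cast sum_indicator_eq

theorem le_iff (h : IsRear m w s) {x : ℕ} (hx : x < m) (t : ℝ) :
    t ≤ s x ↔ x < ((Finset.range m).filter fun i => t ≤ w i).card := by
  rw [← h.card_filter_le]
  refine ⟨fun ht => ?_, fun hlt => by_contra fun ht => hlt.not_ge ?_⟩
  · have range_subset : Finset.range (x + 1) ⊆ (Finset.range m).filter fun i => t ≤ s i := by
      intro i hi
      rw [Finset.mem_range] at hi
      rw [Finset.mem_filter, Finset.mem_range]
      exact ⟨by omega, ht.trans (h.antitone i x (by omega) hx)⟩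
    simpa using Finset.card_le_card range_subset
  · have subset_range : ((Finset.range m).filter fun i => t ≤ s i) ⊆ Finset.range x := by
      intro i hi
      rw [Finset.mem_filter, Finset.mem_range] at hi
      exact Finset.mem_range.2 (not_le.1 fun hxi => ht (hi.2.trans (h.antitone x i hxi hi.1)))
    simpa using Finset.card_le_card subset_range

theorem le_add (h : IsRear m w s) (h' : IsRear m w' s') {δ : ℝ}
    (hw : ∀ i < m, w i ≤ w' i + δ) {x : ℕ} (hx : x < m) : s x ≤ s' x + δ := by
  rw [← sub_le_iff_le_add, h'.le_iff hx]
  refine ((h.le_iff hx _).1 le_rfl).trans_le (Finset.card_le_card fun i hi => ?_)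
  rw [Finset.mem_filter, Finset.mem_range] at hi ⊢
  exact ⟨hi.1, by linarith [hw i hi.1]⟩

theorem abs_sub_le (h : IsRear m w s) (h' : IsRear m w' s') {x : ℕ} (hx : x < m) :
    |s x - s' x| ≤ ∑ i ∈ Finset.range m, |w i - w' i| := by
  have abs_le : ∀ i < m, |w i - w' i| ≤ ∑ i ∈ Finset.range m, |w i - w' i| := fun i hi =>
    abs_le_sum_range (fun i => w i - w' i) hi
  refine abs_sub_le_iff.2 ⟨sub_le_iff_le_add'.2 (h.le_add h' (fun i hi => ?_) hx),
    sub_le_iff_le_add'.2 (h'.le_add h (fun i hi => ?_) hx)⟩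
  · linarith [le_abs_self (w i - w' i), abs_le i hi]
  · linarith [neg_abs_le (w i - w' i), abs_le i hi]

theorem eq_rear (h : IsRear m w s) {x : ℕ} (hx : x < m) : s x = rear m w x :=
  sub_eq_zero.1 (by simpa using h.abs_sub_le (isRear_rear m w) hx)

theorem comp_monotone (h : IsRear m w s) {f : ℝ → ℝ} (hf : Monotone f) :
    IsRear m (fun i => f (w i)) (fun i => f (s i)) where
  antitone i j hij hj := hf (h.antitone i j hij hj)
  sum_comp g := h.sum_comp fun y => g (f y)

theorem append (h : IsRear m w s) (h' : IsRear n (fun i => w (m + i)) t)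
    (hst : ∀ i < m, ∀ j < n, t j ≤ s i) : IsRear (m + n) w (juxtapose m s t) where
  antitone i j hij hj := by
    rcases Nat.lt_or_ge j m with hjm | hjm
    · rw [juxtapose_of_lt hjm, juxtapose_of_lt (hij.trans_lt hjm)]
      exact h.antitone i j hij hjm
    obtain ⟨k, rfl⟩ := Nat.exists_eq_add_of_le hjm
    rw [juxtapose_add]
    rcases Nat.lt_or_ge i m with him | him
    · rw [juxtapose_of_lt him]
      exact hst i him k (by omega)
    · obtain ⟨l, rfl⟩ := Nat.exists_eq_add_of_le him
      rw [juxtapose_add]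
      exact h'.antitone l k (by omega) (by omega)
  sum_comp f := by
    rw [sum_range_add_juxtapose, h.sum_comp, h'.sum_comp, Finset.sum_range_add]

end IsRear

end Rearrangement

section Grenander

/-- `s` is the vector of slopes, on `{0, …, m - 1}`, of the least concave majorant of the partial
sums of `w`: its partial sums form a concave majorant that bends only where it touches. -/
structure IsGren (m : ℕ) (w s : ℕ → ℝ) : Prop where
  succ_le : ∀ i, i + 1 < m → s (i + 1) ≤ s i
  sum_le : ∀ j ≤ m, ∑ i ∈ Finset.range j, w i ≤ ∑ i ∈ Finset.range j, s i
  sum_eq : ∑ i ∈ Finset.range m, s i = ∑ i ∈ Finset.range m, w i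
  flat_or_touch : ∀ j, j + 1 < m →
    s j = s (j + 1) ∨ ∑ i ∈ Finset.range (j + 1), s i = ∑ i ∈ Finset.range (j + 1), w i

theorem gren_of_le {m : ℕ} {w : ℕ → ℝ} {x : ℕ} (h : m ≤ x) : gren m w x = 0 := by
  simp [gren, h.not_gt]

theorem nonneg_of_concave_of_neg {m : ℕ} {d : ℕ → ℝ} (h0 : 0 ≤ d 0) (hm : 0 ≤ d m)
    (hd : ∀ k, k + 2 ≤ m → d (k + 1) < 0 → d k + d (k + 2) ≤ 2 * d (k + 1)) {j : ℕ} (hj : j ≤ m) :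
    0 ≤ d j := by
  classical
  by_contra! hneg
  obtain ⟨a, ha, hmin⟩ := Finset.exists_min_image (Finset.range (m + 1)) d ⟨0, by simp⟩
  replace hmin : ∀ i ≤ m, d a ≤ d i := fun i hi => hmin i (Finset.mem_range.2 (by omega))
  have exists_min : ∃ k, k ≤ m ∧ d k = d a := ⟨a, by simpa [Nat.lt_succ_iff] using ha, rfl⟩
  -- At the first minimizer `k` the left difference is negative, which contradicts concavity.
  obtain ⟨hkm, hk⟩ := Nat.find_spec exists_min
  have lt_of_lt_find : ∀ l < Nat.find exists_min, d a < d l := fun l hl =>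
    (hmin l (by omega)).lt_of_ne fun he => Nat.find_min exists_min hl ⟨by omega, he.symm⟩
  set k := Nat.find exists_min
  have neg_k : d k < 0 := hk ▸ (hmin j hj).trans_lt hneg
  have k_ne_m : k ≠ m := fun h => (h ▸ neg_k).not_ge hm
  obtain ⟨l, hl⟩ := Nat.exists_eq_succ_of_ne_zero fun h : k = 0 => (h ▸ neg_k).not_ge h0
  rw [Nat.succ_eq_add_one] at hl
  have concave := hd l (by omega) (hl ▸ neg_k)
  rw [← hl, hk] at concave
  linarith [lt_of_lt_find l (by omega), hmin (l + 2) (by omega)]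

theorem concaveOn_inf'_affine {ι : Type*} {S : Finset ι} (hS : S.Nonempty) (a b c : ι → ℝ)
    {D : Set ℝ} (hD : Convex ℝ D) :
    ConcaveOn ℝ D fun t => S.inf' hS fun i => a i + b i * (t - c i) := by
  refine ⟨hD, fun x _ y _ u v hu hv huv => Finset.le_inf' _ _ fun i hi => ?_⟩
  have hx := mul_le_mul_of_nonneg_left
    (Finset.inf'_le (fun i => a i + b i * (x - c i)) hi) hu
  have hy := mul_le_mul_of_nonneg_left
    (Finset.inf'_le (fun i => a i + b i * (y - c i)) hi) hv
  obtain rfl : v = 1 - u := by linarith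
  simp only [smul_eq_mul]
  linarith

namespace IsGren

variable {m n : ℕ} {w w' s s' t : ℕ → ℝ}

theorem const {v : ℝ} (hle : ∀ j ≤ m, ∑ i ∈ Finset.range j, w i ≤ j * v)
    (heq : ∑ i ∈ Finset.range m, w i = m * v) : IsGren m w fun _ => v where
  succ_le _ _ := le_rfl
  sum_le j hj := by simpa using hle j hj
  sum_eq := by simp [heq]
  flat_or_touch _ _ := Or.inl rfl

theorem append (h : IsGren m w s) (h' : IsGren n (fun i => w (m + i)) t)
    (hst : ∀ i < m, ∀ j < n, t j ≤ s i) : IsGren (m + n) w (juxtapose m s t) := by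
  have sum_left : ∀ k ≤ m, ∑ i ∈ Finset.range k, juxtapose m s t i = ∑ i ∈ Finset.range k, s i :=
    fun k hk => sum_range_juxtapose hk id
  have sum_right : ∀ k, ∑ i ∈ Finset.range (m + k), juxtapose m s t i =
      ∑ i ∈ Finset.range m, w i + ∑ i ∈ Finset.range k, t i := fun k => by
    rw [← h.sum_eq]
    exact sum_range_add_juxtapose k id
  refine ⟨fun i hi => ?_, fun j hj => ?_, ?_, fun j hj => ?_⟩
  · rcases Nat.lt_trichotomy (i + 1) m with him | rfl | him
    · rw [juxtapose_of_lt him, juxtapose_of_lt (by omega)]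
      exact h.succ_le i him
    · rw [juxtapose_of_lt (Nat.lt_succ_self i)]
      exact (juxtapose_add 0).trans_le (hst i (Nat.lt_succ_self i) 0 (by omega))
    · obtain ⟨k, rfl⟩ := Nat.exists_eq_add_of_le (Nat.le_of_lt_succ him)
      rw [add_assoc, juxtapose_add, juxtapose_add]
      exact h'.succ_le k (by omega)
  · rcases le_total j m with hjm | hjm
    · exact (h.sum_le j hjm).trans_eq (sum_left j hjm).symm
    · obtain ⟨k, rfl⟩ := Nat.exists_eq_add_of_le hjm
      rw [sum_right, Finset.sum_range_add]
      exact add_le_add_right (h'.sum_le k (by omega)) _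
  · rw [sum_right, h'.sum_eq, Finset.sum_range_add]
  · rcases Nat.lt_trichotomy (j + 1) m with hjm | rfl | hjm
    · rw [juxtapose_of_lt hjm, juxtapose_of_lt (by omega), sum_left _ hjm.le]
      exact h.flat_or_touch j hjm
    · exact Or.inr ((sum_left _ le_rfl).trans h.sum_eq)
    · obtain ⟨k, rfl⟩ := Nat.exists_eq_add_of_le (Nat.le_of_lt_succ hjm)
      rw [add_assoc, juxtapose_add, juxtapose_add, sum_right, Finset.sum_range_add w m (k + 1)]
      exact (h'.flat_or_touch k (by omega)).imp id fun e => by rw [e]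

theorem antitone (h : IsGren m w s) {i j : ℕ} (hij : i ≤ j) (hj : j < m) : s j ≤ s i := by
  induction j, hij using Nat.le_induction with
  | base => exact le_rfl
  | succ k _ ih => exact (h.succ_le k hj).trans (ih (by omega))

theorem sum_le_of_concave (h : IsGren m w s) {g : ℕ → ℝ}
    (hg : ∀ k, k + 2 ≤ m → g k + g (k + 2) ≤ 2 * g (k + 1))
    (hwg : ∀ j ≤ m, ∑ i ∈ Finset.range j, w i ≤ g j) {j : ℕ} (hj : j ≤ m) :
    ∑ i ∈ Finset.range j, s i ≤ g j := by
  rw [← sub_nonneg]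
  refine nonneg_of_concave_of_neg (d := fun k => g k - ∑ i ∈ Finset.range k, s i) ?_ ?_
    (fun k hk hneg => ?_) hj
  · simpa using hwg 0 (Nat.zero_le m)
  · exact sub_nonneg.2 (h.sum_eq ▸ hwg m le_rfl)
  · have flat : s k = s (k + 1) := (h.flat_or_touch k hk).resolve_right fun touch => by
      linarith [hwg (k + 1) (by omega)]
    simp only [Finset.sum_range_succ]
    linarith [hg k hk]

theorem sum_le_tangent (h : IsGren m w s) {i j : ℕ} (hi : i < m) (hj : j ≤ m) :
    ∑ k ∈ Finset.range j, s k ≤ ∑ k ∈ Finset.range i, s k + s i * ((j : ℝ) - i) := by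
  rcases le_total i j with hij | hij
  · have sum_Ico_le : ∑ k ∈ Finset.Ico i j, s k ≤ (Finset.Ico i j).card • s i :=
      Finset.sum_le_card_nsmul _ _ _ fun k hk =>
        h.antitone (Finset.mem_Ico.1 hk).1 ((Finset.mem_Ico.1 hk).2.trans_le hj)
    rw [Finset.sum_Ico_eq_sub _ hij, Nat.card_Ico, nsmul_eq_mul, Nat.cast_sub hij] at sum_Ico_le
    linarith
  · have le_sum_Ico : (Finset.Ico j i).card • s i ≤ ∑ k ∈ Finset.Ico j i, s k :=
      Finset.card_nsmul_le_sum _ _ _ fun k hk => h.antitone (Finset.mem_Ico.1 hk).2.le hi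
    rw [Finset.sum_Ico_eq_sub _ hij, Nat.card_Ico, nsmul_eq_mul, Nat.cast_sub hij] at le_sum_Ico
    linarith

theorem exists_concaveOn_eq_sum (h : IsGren m w s) (hm : 0 < m) :
    ∃ g : ℝ → ℝ, ConcaveOn ℝ (Set.Icc 0 (m : ℝ)) g ∧
      ∀ j : ℕ, j ≤ m → g j = ∑ i ∈ Finset.range j, s i := by
  have hne : (Finset.range m).Nonempty := ⟨0, Finset.mem_range.2 hm⟩
  refine ⟨_, concaveOn_inf'_affine hne (fun i => ∑ k ∈ Finset.range i, s k) s (fun i => (i : ℝ))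
    (convex_Icc _ _), fun j hj => le_antisymm ?_ ?_⟩
  · rcases hj.lt_or_eq with hlt | rfl
    · exact (Finset.inf'_le _ (Finset.mem_range.2 hlt)).trans_eq (by simp)
    · obtain ⟨l, rfl⟩ := Nat.exists_eq_succ_of_ne_zero hm.ne'
      refine (Finset.inf'_le _ (Finset.mem_range.2 (Nat.lt_succ_self l))).trans_eq ?_
      rw [Finset.sum_range_succ]
      push_cast
      ring
  · exact Finset.le_inf' _ _ fun i hi => h.sum_le_tangent (Finset.mem_range.1 hi) hj

theorem sum_le_of_concaveOn (h : IsGren m w s) {f : ℝ → ℝ}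
    (hf : ConcaveOn ℝ (Set.Icc 0 (m : ℝ)) f)
    (hwf : ∀ j : ℕ, j ≤ m → ∑ i ∈ Finset.range j, w i ≤ f j) {j : ℕ} (hj : j ≤ m) :
    ∑ i ∈ Finset.range j, s i ≤ f j := by
  refine h.sum_le_of_concave (g := fun k : ℕ => f k) (fun k hk => ?_) hwf hj
  have hkm : (k : ℝ) + 2 ≤ m := by exact_mod_cast hk
  have midpoint_le := hf.2 (x := k) (y := k + 2) ⟨by positivity, by linarith⟩
    ⟨by positivity, hkm⟩ (by norm_num : (0 : ℝ) ≤ 1 / 2) (by norm_num : (0 : ℝ) ≤ 1 / 2)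
    (by norm_num)
  simp only [smul_eq_mul] at midpoint_le
  rw [show 1 / 2 * (k : ℝ) + 1 / 2 * ((k : ℝ) + 2) = (k : ℝ) + 1 by ring] at midpoint_le
  push_cast
  linarith

theorem concaveMajorant_eq (h : IsGren m w s) (hm : 0 < m) {j : ℕ} (hj : j ≤ m) :
    concaveMajorant m w j = ∑ i ∈ Finset.range j, s i := by
  obtain ⟨g, concave_g, g_eq⟩ := h.exists_concaveOn_eq_sum hm
  refine IsLeast.csInf_eq ⟨⟨g, ⟨concave_g, fun k hk => ?_⟩, g_eq j hj⟩, ?_⟩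
  · exact (h.sum_le k hk).trans_eq (g_eq k hk).symm
  · rintro _ ⟨f, ⟨concave_f, hwf⟩, rfl⟩
    exact h.sum_le_of_concaveOn concave_f hwf hj

theorem eq_gren (h : IsGren m w s) {x : ℕ} (hx : x < m) : s x = gren m w x := by
  have majorant_succ := h.concaveMajorant_eq (by omega) (show x + 1 ≤ m from hx)
  rw [Nat.cast_succ] at majorant_succ
  rw [gren, if_pos hx, majorant_succ, h.concaveMajorant_eq (by omega) hx.le,
    Finset.sum_range_succ, add_sub_cancel_left]

theorem congr (h : IsGren m w s) (hs : ∀ i < m, s i = s' i) : IsGren m w s' := by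
  have sum_congr : ∀ j ≤ m, ∑ i ∈ Finset.range j, s i = ∑ i ∈ Finset.range j, s' i :=
    fun j hj => Finset.sum_congr rfl fun i hi => hs i ((Finset.mem_range.1 hi).trans_le hj)
  refine ⟨fun i hi => ?_, fun j hj => ?_, ?_, fun j hj => ?_⟩
  · rw [← hs _ hi, ← hs i (by omega)]
    exact h.succ_le i hi
  · rw [← sum_congr j hj]
    exact h.sum_le j hj
  · rw [← sum_congr m le_rfl, h.sum_eq]
  · rw [← hs _ hj, ← hs j (by omega), ← sum_congr _ hj.le]
    exact h.flat_or_touch j hj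

theorem apply_zero_le (h : IsGren m w s) (hm : 0 < m) {v : ℝ}
    (hv : ∀ j ≤ m, ∑ i ∈ Finset.range j, w i ≤ j * v) : s 0 ≤ v := by
  have sum_le := h.sum_le_of_concave (g := fun j => j * v) (fun k _ => ?_) hv
    (Nat.succ_le_of_lt hm)
  · simpa using sum_le
  · push_cast
    linarith

theorem nonneg (h : IsGren m w s) (hw : ∀ i < m, 0 ≤ w i) {x : ℕ} (hx : x < m) : 0 ≤ s x := by
  obtain ⟨l, rfl⟩ := Nat.exists_eq_succ_of_ne_zero (Nat.ne_zero_of_lt hx)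
  refine le_trans ?_ (h.antitone (Nat.le_of_lt_succ hx) (Nat.lt_succ_self l))
  have sum_le := h.sum_le_of_concave (g := fun _ => ∑ i ∈ Finset.range (l + 1), s i)
    (fun k _ => (two_mul _).ge) (fun j hj => ?_) (Nat.le_succ l)
  · rw [Finset.sum_range_succ] at sum_le
    linarith
  · rw [h.sum_eq]
    exact Finset.sum_le_sum_of_subset_of_nonneg (Finset.range_mono hj) fun i hi _ =>
      hw i (Finset.mem_range.1 hi)

theorem sum_le_add (h : IsGren m w s) (h' : IsGren m w' s') {j : ℕ} (hj : j ≤ m) :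
    ∑ i ∈ Finset.range j, s i ≤
      ∑ i ∈ Finset.range j, s' i + ∑ i ∈ Finset.range m, |w i - w' i| := by
  refine h.sum_le_of_concave
    (g := fun j => ∑ i ∈ Finset.range j, s' i + ∑ i ∈ Finset.range m, |w i - w' i|)
    (fun k hk => ?_) (fun k hk => ?_) hj
  · simp only [Finset.sum_range_succ]
    linarith [h'.succ_le k hk]
  · have sum_sub_le : ∑ i ∈ Finset.range k, (w i - w' i) ≤ ∑ i ∈ Finset.range m, |w i - w' i| :=
      (Finset.sum_le_sum fun i _ => le_abs_self _).trans
        (Finset.sum_le_sum_of_subset_of_nonneg (Finset.range_mono hk) fun _ _ _ => abs_nonneg _)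
    rw [Finset.sum_sub_distrib] at sum_sub_le
    linarith [h'.sum_le k hk]

theorem abs_sub_le (h : IsGren m w s) (h' : IsGren m w' s') {x : ℕ} (hx : x < m) :
    |s x - s' x| ≤ 2 * ∑ i ∈ Finset.range m, |w i - w' i| := by
  have hle := h.sum_le_add h' hx.le
  have hle_succ := h.sum_le_add h' (show x + 1 ≤ m from hx)
  have hge := h'.sum_le_add h hx.le
  have hge_succ := h'.sum_le_add h (show x + 1 ≤ m from hx)
  simp only [Finset.sum_range_succ, abs_sub_comm (w' _)] at hle_succ hge hge_succ
  exact abs_le.2 ⟨by linarith, by linarith⟩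

theorem const_mul (h : IsGren m w s) {c : ℝ} (hc : 0 ≤ c) :
    IsGren m (fun i => c * w i) (fun i => c * s i) where
  succ_le i hi := mul_le_mul_of_nonneg_left (h.succ_le i hi) hc
  sum_le j hj := by
    simp only [← Finset.mul_sum]
    exact mul_le_mul_of_nonneg_left (h.sum_le j hj) hc
  sum_eq := by simp only [← Finset.mul_sum, h.sum_eq]
  flat_or_touch j hj := by
    simp only [← Finset.mul_sum]
    exact (h.flat_or_touch j hj).imp (fun e => by rw [e]) fun e => by rw [e]

theorem add_const (h : IsGren m w s) (c : ℝ) :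
    IsGren m (fun i => w i + c) (fun i => s i + c) where
  succ_le i hi := add_le_add_left (h.succ_le i hi) c
  sum_le j hj := by
    simp only [Finset.sum_add_distrib]
    exact add_le_add_left (h.sum_le j hj) _
  sum_eq := by simp only [Finset.sum_add_distrib, h.sum_eq]
  flat_or_touch j hj := by
    simp only [Finset.sum_add_distrib]
    exact (h.flat_or_touch j hj).imp (fun e => by rw [e]) fun e => by rw [e]

theorem exists_touch_right (h : IsGren m w s) {a : ℕ} (ha : a < m) :
    ∃ b, a < b ∧ b ≤ m ∧ ∑ i ∈ Finset.range b, s i = ∑ i ∈ Finset.range b, w i ∧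
      ∀ i, a ≤ i → i < b → s i = s a := by
  classical
  have exists_touch : ∃ b, a < b ∧ ∑ i ∈ Finset.range b, s i = ∑ i ∈ Finset.range b, w i :=
    ⟨m, ha, h.sum_eq⟩
  have find_le : Nat.find exists_touch ≤ m := Nat.find_min' exists_touch ⟨ha, h.sum_eq⟩
  obtain ⟨lt_find, touch⟩ := Nat.find_spec exists_touch
  refine ⟨Nat.find exists_touch, lt_find, find_le, touch, fun i hai => ?_⟩
  induction i, hai using Nat.le_induction with
  | base => exact fun _ => rfl
  | succ k hk ih =>
    intro hlt
    rw [← ih (by omega)]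
    refine ((h.flat_or_touch k (by omega)).resolve_right fun touch_k => ?_).symm
    exact Nat.find_min exists_touch hlt ⟨by omega, touch_k⟩

theorem exists_touch_left (h : IsGren m w s) {x : ℕ} (hx : x < m) :
    ∃ a ≤ x, ∑ i ∈ Finset.range a, s i = ∑ i ∈ Finset.range a, w i ∧
      ∀ i, a ≤ i → i ≤ x → s i = s x := by
  induction x with
  | zero => exact ⟨0, le_rfl, by simp, fun i _ hi => by rw [Nat.le_zero.1 hi]⟩
  | succ k ih =>
    rcases h.flat_or_touch k hx with flat | touch
    · obtain ⟨a, ha, touch_a, const_a⟩ := ih (by omega)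
      refine ⟨a, by omega, touch_a, fun i hai hi => ?_⟩
      rcases Nat.lt_or_ge k i with hki | hki
      · rw [show i = k + 1 by omega]
      · rw [const_a i hai hki, flat]
    · exact ⟨k + 1, le_rfl, touch, fun i h1 h2 => by rw [le_antisymm h2 h1]⟩

theorem sum_lt_of_flat (h : IsGren m w s) (hw : HasDistinctAverages m w) {j : ℕ} (hj : j + 1 < m)
    (flat : s (j + 1) = s j) :
    ∑ i ∈ Finset.range (j + 1), w i < ∑ i ∈ Finset.range (j + 1), s i := by
  refine (h.sum_le _ hj.le).lt_of_ne fun touch => ?_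
  obtain ⟨a, ha, touch_a, const_a⟩ := h.exists_touch_left (show j < m by omega)
  obtain ⟨b, hb, hbm, touch_b, const_b⟩ := h.exists_touch_right hj
  have sum_left : ∑ i ∈ Finset.Ico a (j + 1), w i = (Finset.Ico a (j + 1)).card * s j := by
    rw [Finset.sum_Ico_eq_sub _ (by omega), touch, ← touch_a,
      ← Finset.sum_Ico_eq_sub _ (by omega), ← nsmul_eq_mul]
    exact Finset.sum_eq_card_nsmul fun i hi =>
      const_a i (Finset.mem_Ico.1 hi).1 (Nat.lt_succ_iff.1 (Finset.mem_Ico.1 hi).2)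
  have sum_right : ∑ i ∈ Finset.Ico (j + 1) b, w i = (Finset.Ico (j + 1) b).card * s j := by
    rw [Finset.sum_Ico_eq_sub _ hb.le, touch, ← touch_b,
      ← Finset.sum_Ico_eq_sub _ hb.le, ← nsmul_eq_mul]
    exact Finset.sum_eq_card_nsmul fun i hi =>
      (const_b i (Finset.mem_Ico.1 hi).1 (Finset.mem_Ico.1 hi).2).trans flat
  have Ico_subset : ∀ {c d}, d ≤ m → Finset.Ico c d ⊆ Finset.range m := fun hd i hi =>
    Finset.mem_range.2 ((Finset.mem_Ico.1 hi).2.trans_le hd)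
  refine hw _ (Ico_subset hj.le) _ (Ico_subset hbm)
    (Finset.Ico_disjoint_Ico_consecutive a (j + 1) b) (Finset.nonempty_Ico.2 (by omega))
    (Finset.nonempty_Ico.2 hb) ?_
  rw [sum_left, sum_right]
  ring

end IsGren

-- Greedy construction: the first linear piece ends at a prefix of maximal average.
theorem exists_isGren (m : ℕ) (w : ℕ → ℝ) : ∃ s, IsGren m w s := by
  induction m using Nat.strong_induction_on generalizing w with
  | _ m ih =>
  rcases Nat.eq_zero_or_pos m with rfl | hm
  · exact ⟨0, by simp, fun j hj => by simp [Nat.le_zero.1 hj], by simp, by simp⟩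
  obtain ⟨b, hb, hmax⟩ := Finset.exists_max_image (Finset.Icc 1 m)
    (fun k : ℕ => (∑ i ∈ Finset.range k, w i) / k) ⟨1, Finset.mem_Icc.2 ⟨le_rfl, hm⟩⟩
  rw [Finset.mem_Icc] at hb
  obtain ⟨n, rfl⟩ := Nat.exists_eq_add_of_le hb.2
  set v := (∑ i ∈ Finset.range b, w i) / b
  have b_ne_zero : (b : ℝ) ≠ 0 := Nat.cast_ne_zero.2 (by omega)
  have sum_eq : ∑ i ∈ Finset.range b, w i = b * v := (mul_div_cancel₀ _ b_ne_zero).symm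
  have sum_le : ∀ k ≤ b + n, ∑ i ∈ Finset.range k, w i ≤ k * v := fun k hk => by
    rcases Nat.eq_zero_or_pos k with rfl | hk0
    · simp
    exact (div_le_iff₀' (by exact_mod_cast hk0)).1 (hmax k (Finset.mem_Icc.2 ⟨hk0, hk⟩))
  obtain ⟨t, ht⟩ := ih n (by omega) fun i => w (b + i)
  refine ⟨_, (IsGren.const (fun k hk => sum_le k (by omega)) sum_eq).append ht fun i _ j hj => ?_⟩
  refine (ht.antitone (Nat.zero_le j) hj).trans (ht.apply_zero_le (by omega) fun k hk => ?_)
  have sum_le_add := sum_le (b + k) (by omega)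
  rw [Finset.sum_range_add, sum_eq, Nat.cast_add] at sum_le_add
  linarith

theorem isGren_gren (m : ℕ) (w : ℕ → ℝ) : IsGren m w (gren m w) := by
  obtain ⟨s, hs⟩ := exists_isGren m w
  exact hs.congr fun i hi => hs.eq_gren hi

end Grenander

section BlockOperators

/-- The properties shared by truncation, `rear` and `gren` on which the limit theorem rests. By
`append`, such an operator acts separately on the two parts of a vector whenever this does not
destroy the order between the parts; `ne_or_eventually_eq` says that ties in the result are generic
only if they persist in a neighbourhood. -/
structure IsBlockOperator (φ : ℕ → (ℕ → ℝ) → ℕ → ℝ) : Prop where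
  eq_zero_of_le : ∀ m w x, m ≤ x → φ m w x = 0
  const_mul : ∀ m w (c : ℝ), 0 ≤ c → ∀ x, φ m (fun i => c * w i) x = c * φ m w x
  add_const : ∀ m w (c : ℝ), ∀ x < m, φ m (fun i => w i + c) x = φ m w x + c
  lipschitz : ∀ m w w' x, |φ m w x - φ m w' x| ≤ 2 * ∑ i ∈ Finset.range m, |w i - w' i|
  nonneg : ∀ m w, (∀ i < m, 0 ≤ w i) → ∀ x, 0 ≤ φ m w x
  append : ∀ m n w, (∀ i < m, ∀ j < n, φ n (fun i => w (m + i)) j ≤ φ m w i) →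
    φ (m + n) w = juxtapose m (φ m w) (φ n fun i => w (m + i))
  sum_eq : ∀ m w, ∑ i ∈ Finset.range m, φ m w i = ∑ i ∈ Finset.range m, w i
  apply_zero_le : ∀ m w, 0 < m → w 0 ≤ φ m w 0
  ne_or_eventually_eq : ∀ m w, HasDistinctAverages m w → ∀ j, j + 1 < m →
    φ m w (j + 1) ≠ φ m w j ∨ ∀ᶠ v in 𝓝 w, φ m v (j + 1) = φ m v j

/-- Restriction of a sequence to `{0, …, m - 1}`: the operator that turns the empirical mass
function into itself. -/
def truncate (m : ℕ) (w : ℕ → ℝ) : ℕ → ℝ := fun x => if x < m then w x else 0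

variable {m n : ℕ}

theorem truncate_of_lt {w : ℕ → ℝ} {x : ℕ} (hx : x < m) : truncate m w x = w x := if_pos hx

theorem truncate_of_le {w : ℕ → ℝ} {x : ℕ} (hx : m ≤ x) : truncate m w x = 0 := if_neg hx.not_gt

theorem abs_sub_le_two_mul_sum {u v w w' : ℕ → ℝ} (hu : ∀ x, m ≤ x → u x = 0)
    (hv : ∀ x, m ≤ x → v x = 0)
    (h : ∀ x < m, |u x - v x| ≤ 2 * ∑ i ∈ Finset.range m, |w i - w' i|) (x : ℕ) :
    |u x - v x| ≤ 2 * ∑ i ∈ Finset.range m, |w i - w' i| := by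
  rcases Nat.lt_or_ge x m with hx | hx
  · exact h x hx
  · rw [hu x hx, hv x hx, sub_self, abs_zero]
    exact mul_nonneg zero_le_two (Finset.sum_nonneg fun _ _ => abs_nonneg _)

theorem eq_juxtapose {u s t : ℕ → ℝ} (hu : ∀ x, m + n ≤ x → u x = 0) (ht : ∀ x, n ≤ x → t x = 0)
    (h : ∀ x < m + n, juxtapose m s t x = u x) : u = juxtapose m s t := by
  funext x
  rcases Nat.lt_or_ge x (m + n) with hx | hx
  · exact (h x hx).symm
  · obtain ⟨k, rfl⟩ := Nat.exists_eq_add_of_le ((Nat.le_add_right m n).trans hx)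
    rw [hu _ hx, juxtapose_add, ht k (by omega)]

theorem isBlockOperator_truncate : IsBlockOperator truncate where
  eq_zero_of_le _ _ _ := truncate_of_le
  const_mul m w c _ x := by simp [truncate]
  add_const m w c x hx := by simp [truncate, hx]
  lipschitz m w w' :=
    abs_sub_le_two_mul_sum (fun _ => truncate_of_le) (fun _ => truncate_of_le) fun x hx => by
      rw [truncate_of_lt hx, truncate_of_lt hx]
      linarith [abs_le_sum_range (fun i => w i - w' i) hx, abs_nonneg (w x - w' x)]
  nonneg m w hw x := by
    unfold truncate
    split_ifs with hx
    exacts [hw x hx, le_rfl]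
  append m n w _ := by
    refine eq_juxtapose (fun _ => truncate_of_le) (fun _ => truncate_of_le) fun x hx => ?_
    rw [truncate_of_lt hx]
    rcases Nat.lt_or_ge x m with hxm | hxm
    · rw [juxtapose_of_lt hxm, truncate_of_lt hxm]
    · obtain ⟨k, rfl⟩ := Nat.exists_eq_add_of_le hxm
      rw [juxtapose_add, truncate_of_lt (by omega)]
  sum_eq m w := Finset.sum_congr rfl fun i hi => truncate_of_lt (Finset.mem_range.1 hi)
  apply_zero_le m w hm := (truncate_of_lt hm).ge
  ne_or_eventually_eq m w hw j hj := by
    rw [truncate_of_lt hj, truncate_of_lt (by omega)]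
    exact Or.inl (hw.ne hj (by omega) (Nat.succ_ne_self j))

theorem isBlockOperator_rear : IsBlockOperator rear where
  eq_zero_of_le _ _ _ := rear_of_le
  const_mul m w c hc x := by
    rcases Nat.lt_or_ge x m with hx | hx
    · exact (((isRear_rear m w).comp_monotone (monotone_mul_left_of_nonneg hc)).eq_rear hx).symm
    · rw [rear_of_le hx, rear_of_le hx, mul_zero]
  add_const m w c x hx :=
    (((isRear_rear m w).comp_monotone fun _ _ h => add_le_add_left h c).eq_rear hx).symm
  lipschitz m w w' :=
    abs_sub_le_two_mul_sum (fun _ => rear_of_le) (fun _ => rear_of_le) fun x hx => by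
      have abs_sub_le := (isRear_rear m w).abs_sub_le (isRear_rear m w') hx
      linarith [abs_nonneg (rear m w x - rear m w' x)]
  nonneg m w hw x := by
    rcases Nat.lt_or_ge x m with hx | hx
    · obtain ⟨i, hi, rear_eq⟩ := exists_rear_eq w hx
      exact rear_eq ▸ hw i hi
    · exact (rear_of_le hx).ge
  append m n w h := eq_juxtapose (fun _ => rear_of_le) (fun _ => rear_of_le) fun _ hx =>
    ((isRear_rear m w).append (isRear_rear n _) h).eq_rear hx
  sum_eq m w := (isRear_rear m w).sum_comp id
  apply_zero_le m w hm := ((isRear_rear m w).le_iff hm (w 0)).2 <|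
    Finset.card_pos.2 ⟨0, Finset.mem_filter.2 ⟨Finset.mem_range.2 hm, le_rfl⟩⟩
  ne_or_eventually_eq m w hw j hj := Or.inl (hw.rear_ne hj (by omega) (Nat.succ_ne_self j))

theorem continuous_of_abs_sub_le {f : (ℕ → ℝ) → ℝ} (C : ℝ)
    (h : ∀ w w', |f w - f w'| ≤ C * ∑ i ∈ Finset.range m, |w i - w' i|) : Continuous f := by
  refine continuous_iff_continuousAt.2 fun w => tendsto_iff_dist_tendsto_zero.2 ?_
  have continuous_bound : Continuous fun v : ℕ → ℝ => C * ∑ i ∈ Finset.range m, |v i - w i| := by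
    fun_prop
  exact squeeze_zero (fun _ => dist_nonneg) (fun v => h v w)
    (by simpa using continuous_bound.tendsto w)

theorem abs_gren_sub_le (w w' : ℕ → ℝ) (x : ℕ) :
    |gren m w x - gren m w' x| ≤ 2 * ∑ i ∈ Finset.range m, |w i - w' i| :=
  abs_sub_le_two_mul_sum (fun _ => gren_of_le) (fun _ => gren_of_le)
    (fun _ => (isGren_gren m w).abs_sub_le (isGren_gren m w')) x

theorem continuous_gren : Continuous (gren m) :=
  continuous_pi fun x => continuous_of_abs_sub_le 2 fun w w' => abs_gren_sub_le w w' x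

theorem eventually_gren_succ_eq {w : ℕ → ℝ} (hw : HasDistinctAverages m w) {j : ℕ}
    (hj : j + 1 < m) (flat : gren m w (j + 1) = gren m w j) :
    ∀ᶠ v in 𝓝 w, gren m v (j + 1) = gren m v j := by
  have continuous_sum : Continuous fun v : ℕ → ℝ => ∑ i ∈ Finset.range (j + 1), v i := by fun_prop
  filter_upwards [(continuous_sum.tendsto w).eventually_lt
    ((continuous_sum.comp continuous_gren).tendsto w)
    ((isGren_gren m w).sum_lt_of_flat hw hj flat)] with v hv
  exact (((isGren_gren m v).flat_or_touch j hj).resolve_right hv.ne').symm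

theorem isBlockOperator_gren : IsBlockOperator gren where
  eq_zero_of_le _ _ _ := gren_of_le
  const_mul m w c hc x := by
    rcases Nat.lt_or_ge x m with hx | hx
    · exact (((isGren_gren m w).const_mul hc).eq_gren hx).symm
    · rw [gren_of_le hx, gren_of_le hx, mul_zero]
  add_const m w c _ hx := (((isGren_gren m w).add_const c).eq_gren hx).symm
  lipschitz _ := abs_gren_sub_le
  nonneg m w hw x := by
    rcases Nat.lt_or_ge x m with hx | hx
    · exact (isGren_gren m w).nonneg hw hx
    · exact (gren_of_le hx).ge
  append m n w h := eq_juxtapose (fun _ => gren_of_le) (fun _ => gren_of_le) fun _ hx =>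
    ((isGren_gren m w).append (isGren_gren n _) h).eq_gren hx
  sum_eq m w := (isGren_gren m w).sum_eq
  apply_zero_le m w hm := by simpa using (isGren_gren m w).sum_le 1 hm
  ne_or_eventually_eq m w hw _ hj := or_iff_not_imp_left.2 fun h =>
    eventually_gren_succ_eq hw hj (not_not.1 h)

namespace IsBlockOperator

variable {φ : ℕ → (ℕ → ℝ) → ℕ → ℝ} {w w' : ℕ → ℝ}

theorem congr (hφ : IsBlockOperator φ) (h : ∀ i < m, w i = w' i) : φ m w = φ m w' := by
  have sum_eq_zero : ∑ i ∈ Finset.range m, |w i - w' i| = 0 := Finset.sum_eq_zero fun i hi => by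
    rw [h i (Finset.mem_range.1 hi), sub_self, abs_zero]
  exact funext fun x => sub_eq_zero.1 (by simpa [sum_eq_zero] using hφ.lipschitz m w w' x)

theorem map_zero (hφ : IsBlockOperator φ) : φ m (fun _ => 0) = fun _ => 0 :=
  funext fun x => by simpa using hφ.const_mul m (fun _ => 0) 0 le_rfl x

theorem abs_apply_le (hφ : IsBlockOperator φ) (x : ℕ) :
    |φ m w x| ≤ 2 * ∑ i ∈ Finset.range m, |w i| := by
  simpa [hφ.map_zero] using hφ.lipschitz m w (fun _ => 0) x

theorem continuous (hφ : IsBlockOperator φ) (m : ℕ) : Continuous (φ m) :=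
  continuous_pi fun x => continuous_of_abs_sub_le 2 fun w w' => hφ.lipschitz m w w' x

end IsBlockOperator

end BlockOperators

section Blocks

/-- First point of the interval of constancy of `p` through `x`. -/
def blockStart (p : ℕ → ℝ) (x : ℕ) : ℕ := sInf {z | p z = p x}

/-- Length of the interval of constancy of `p` through `x`. -/
def blockLength (p : ℕ → ℝ) (x : ℕ) : ℕ := {z | p z = p x}.ncard

theorem exists_gap (p : ℕ → ℝ) (k : ℕ) :
    ∃ η > 0, ∀ i ≤ k, ∀ j ≤ k, p j < p i → p j + η ≤ p i := by
  have eventually_gap : ∀ᶠ η in 𝓝[>] (0 : ℝ), ∀ i ∈ Set.Iic k, ∀ j ∈ Set.Iic k,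
      p j < p i → p j + η ≤ p i := by
    simp only [(Set.finite_Iic k).eventually_all]
    refine fun i _ j _ => eventually_imp_distrib_left.2 fun h => ?_
    filter_upwards [eventually_nhdsWithin_of_eventually_nhds (eventually_lt_nhds (sub_pos.2 h))]
      with η hη
    linarith
  obtain ⟨η, hgap, hη⟩ := (eventually_gap.and self_mem_nhdsWithin).exists
  exact ⟨η, hη, hgap⟩

variable {p : ℕ → ℝ} (hp : IsDecreasingPMF p) (hκ : BddAbove {x | 0 < p x}) {x : ℕ}

include hp hκ

theorem eq_iff_mem_block (hx : x ≤ supportEnd p) (z : ℕ) :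
    p z = p x ↔ blockStart p x ≤ z ∧ z < blockStart p x + blockLength p x := by
  have bddAbove : BddAbove {z | p z = p x} :=
    ⟨supportEnd p, fun z hz => (hp.pos_iff_le_supportEnd hκ).1
      (hz.symm ▸ (hp.pos_iff_le_supportEnd hκ).2 hx)⟩
  have apply_start : p (blockStart p x) = p x := Nat.sInf_mem (s := {z | p z = p x}) ⟨x, rfl⟩
  have apply_last : p (sSup {z | p z = p x}) = p x :=
    Nat.sSup_mem (s := {z | p z = p x}) ⟨x, rfl⟩ bddAbove
  have start_le_last : blockStart p x ≤ sSup {z | p z = p x} := le_csSup bddAbove apply_start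
  have block_eq_Icc : {z | p z = p x} = Set.Icc (blockStart p x) (sSup {z | p z = p x}) :=
    Set.ext fun z => ⟨fun hz => ⟨Nat.sInf_le hz, le_csSup bddAbove hz⟩, fun hz =>
      le_antisymm (apply_start ▸ hp.antitone hz.1) (apply_last ▸ hp.antitone hz.2)⟩
  have length_eq : blockLength p x = sSup {z | p z = p x} + 1 - blockStart p x :=
    (congrArg Set.ncard block_eq_Icc).trans (by
      rw [← Finset.coe_Icc, Set.ncard_coe_finset, Nat.card_Icc])
  rw [show p z = p x ↔ z ∈ Set.Icc _ _ from Set.ext_iff.1 block_eq_Icc z, Set.mem_Icc, length_eq]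
  omega

theorem blockStart_le (hx : x ≤ supportEnd p) : blockStart p x ≤ x :=
  ((eq_iff_mem_block hp hκ hx x).1 rfl).1

theorem lt_blockStart_add (hx : x ≤ supportEnd p) : x < blockStart p x + blockLength p x :=
  ((eq_iff_mem_block hp hκ hx x).1 rfl).2

theorem apply_blockStart_add (hx : x ≤ supportEnd p) {j : ℕ} (hj : j < blockLength p x) :
    p (blockStart p x + j) = p x :=
  (eq_iff_mem_block hp hκ hx _).2 ⟨by omega, by omega⟩

theorem lt_apply_of_lt_blockStart (hx : x ≤ supportEnd p) {i : ℕ} (hi : i < blockStart p x) :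
    p x < p i :=
  (hp.antitone (hi.le.trans (blockStart_le hp hκ hx))).lt_of_ne fun h =>
    hi.not_ge ((eq_iff_mem_block hp hκ hx i).1 h.symm).1

theorem blockStart_add_le (hx : x ≤ supportEnd p) :
    blockStart p x + blockLength p x ≤ supportEnd p + 1 := by
  have hle := blockStart_le hp hκ hx
  have hlt := lt_blockStart_add hp hκ hx
  have apply_last := apply_blockStart_add hp hκ hx (j := blockLength p x - 1) (by omega)
  have last_le := (hp.pos_iff_le_supportEnd hκ).1
    (apply_last ▸ (hp.pos_iff_le_supportEnd hκ).2 hx)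
  omega

theorem blockStart_add_of_succ_eq_blockStart {z : ℕ} (hx : x ≤ supportEnd p)
    (hz : z + 1 = blockStart p x) : blockStart p z + blockLength p z = blockStart p x := by
  have hle := blockStart_le hp hκ hx
  have hzκ : z ≤ supportEnd p := by omega
  have apply_start := apply_blockStart_add hp hκ hx (j := 0)
    (by have := lt_blockStart_add hp hκ hx; omega)
  have hlt := lt_apply_of_lt_blockStart hp hκ hx (i := z) (by omega)
  have not_mem_block := mt (eq_iff_mem_block hp hκ hzκ (z + 1)).2
    (by rw [hz, ← add_zero (blockStart p x), apply_start]; exact hlt.ne)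
  have := blockStart_le hp hκ hzκ
  have := lt_blockStart_add hp hκ hzκ
  omega

theorem sum_block_le (hx : x ≤ supportEnd p) {f : ℕ → ℝ} (hf : ∀ i, 0 ≤ f i) :
    ∑ i ∈ Finset.range (blockLength p x), f (blockStart p x + i) ≤
      ∑ i ∈ Finset.range (supportEnd p + 1), f i := by
  refine le_trans ?_ (Finset.sum_le_sum_of_subset_of_nonneg
    (Finset.range_mono (blockStart_add_le hp hκ hx)) fun i _ _ => hf i)
  rw [Finset.sum_range_add]
  exact le_add_of_nonneg_left (Finset.sum_nonneg fun i _ => hf i)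

section Blockwise

variable {φ : ℕ → (ℕ → ℝ) → ℕ → ℝ} (y : ℕ → ℝ)

theorem blockwise_eq (hx : x ≤ supportEnd p) : blockwise φ p y x =
    φ (blockLength p x) (fun i => y (blockStart p x + i)) (x - blockStart p x) :=
  if_pos ((hp.pos_iff_le_supportEnd hκ).2 hx)

theorem blockwise_blockStart_add (hx : x ≤ supportEnd p) {j : ℕ} (hj : j < blockLength p x) :
    blockwise φ p y (blockStart p x + j) =
      φ (blockLength p x) (fun i => y (blockStart p x + i)) j := by
  have apply_eq := apply_blockStart_add hp hκ hx hj
  have hle : blockStart p x + j ≤ supportEnd p := by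
    have := blockStart_add_le hp hκ hx
    omega
  have start_eq : blockStart p (blockStart p x + j) = blockStart p x :=
    congrArg (fun v => sInf {z | p z = v}) apply_eq
  have length_eq : blockLength p (blockStart p x + j) = blockLength p x :=
    congrArg (fun v => {z | p z = v}.ncard) apply_eq
  rw [blockwise_eq hp hκ y hle, start_eq, length_eq, Nat.add_sub_cancel_left]

theorem blockwise_of_lt (hx : supportEnd p < x) : blockwise φ p y x = y x :=
  if_neg (hp.eq_zero_of_supportEnd_lt hκ hx).not_gt

theorem blockwise_truncate : blockwise truncate p y = y := by
  funext x
  rcases le_or_gt x (supportEnd p) with hx | hx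
  · have hle := blockStart_le hp hκ hx
    have hlt := lt_blockStart_add hp hκ hx
    rw [blockwise_eq hp hκ y hx, truncate_of_lt (by omega), Nat.add_sub_cancel' hle]
  · exact blockwise_of_lt hp hκ y hx

theorem abs_blockwise_le (hφ : IsBlockOperator φ) (hx : x ≤ supportEnd p) :
    |blockwise φ p y x| ≤ 2 * ∑ i ∈ Finset.range (supportEnd p + 1), |y i| := by
  rw [blockwise_eq hp hκ y hx]
  refine (hφ.abs_apply_le _).trans (mul_le_mul_of_nonneg_left ?_ zero_le_two)
  exact sum_block_le hp hκ hx (f := fun i => |y i|) fun _ => abs_nonneg _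

omit hp hκ in
theorem blockwise_const_mul (hφ : IsBlockOperator φ) {c : ℝ} (hc : 0 ≤ c) :
    blockwise φ p (fun i => c * y i) x = c * blockwise φ p y x := by
  unfold blockwise
  split_ifs
  · exact hφ.const_mul _ _ c hc _
  · rfl

theorem continuous_blockwise (hφ : IsBlockOperator φ) : Continuous (blockwise φ p) := by
  refine continuous_pi fun x => ?_
  rcases le_or_gt x (supportEnd p) with hx | hx
  · simp only [blockwise_eq hp hκ _ hx]
    have continuous_block : Continuous fun (y : ℕ → ℝ) i => y (blockStart p x + i) := by fun_prop
    exact (continuous_apply _).comp ((hφ.continuous _).comp continuous_block)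
  · simp only [blockwise_of_lt hp hκ _ hx]
    exact continuous_apply x

theorem apply_block_add (hφ : IsBlockOperator φ) (hx : x ≤ supportEnd p) {j : ℕ}
    (hj : j < blockLength p x) :
    φ (blockLength p x) (fun i => p (blockStart p x + i) + y (blockStart p x + i)) j =
      p (blockStart p x + j) + blockwise φ p y (blockStart p x + j) := by
  rw [blockwise_blockStart_add hp hκ y hx hj, apply_blockStart_add hp hκ hx hj, add_comm,
    ← hφ.add_const _ _ (p x) j hj]
  refine congrFun (hφ.congr fun i hi => ?_) j
  rw [apply_blockStart_add hp hκ hx hi, add_comm]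

theorem apply_prefix_add (hφ : IsBlockOperator φ)
    (ordered : ∀ i ≤ supportEnd p, ∀ j ≤ supportEnd p, p j < p i →
      p j + blockwise φ p y j ≤ p i + blockwise φ p y i) (x : ℕ) (hx : x ≤ supportEnd p) :
    ∀ i < blockStart p x + blockLength p x,
      φ (blockStart p x + blockLength p x) (fun i => p i + y i) i = p i + blockwise φ p y i := by
  induction x using Nat.strong_induction_on with
  | _ x ih =>
  have block_eq := fun j => apply_block_add hp hκ y hφ hx (j := j)
  rcases Nat.eq_zero_or_eq_succ_pred (blockStart p x) with start_eq | start_eq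
  · simpa only [start_eq, zero_add] using block_eq
  have start_le := blockStart_le hp hκ hx
  have end_le := blockStart_add_le hp hκ hx
  have prefix_eq := ih (blockStart p x).pred (by omega) (by omega)
  rw [blockStart_add_of_succ_eq_blockStart hp hκ hx start_eq.symm] at prefix_eq
  intro i hi
  rw [hφ.append _ _ _ fun i hi j hj => ?_]
  · rcases Nat.lt_or_ge i (blockStart p x) with his | his
    · rw [juxtapose_of_lt his, prefix_eq i his]
    · obtain ⟨j, rfl⟩ := Nat.exists_eq_add_of_le his
      rw [juxtapose_add, block_eq j (by omega)]
  · rw [block_eq j hj, prefix_eq i hi]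
    refine ordered i (by omega) _ (by omega) ?_
    exact apply_blockStart_add hp hκ hx hj ▸ lt_apply_of_lt_blockStart hp hκ hx hi

theorem exists_apply_add_eq_add_blockwise (hφ : IsBlockOperator φ) :
    ∃ δ > 0, ∀ y : ℕ → ℝ, ∑ i ∈ Finset.range (supportEnd p + 1), |y i| ≤ δ →
      ∀ x ≤ supportEnd p,
        φ (supportEnd p + 1) (fun i => p i + y i) x = p x + blockwise φ p y x := by
  obtain ⟨η, hη, gap⟩ := exists_gap p (supportEnd p)
  refine ⟨η / 4, by positivity, fun y hy x hx => ?_⟩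
  have ordered : ∀ i ≤ supportEnd p, ∀ j ≤ supportEnd p, p j < p i →
      p j + blockwise φ p y j ≤ p i + blockwise φ p y i := fun i hi j hj hlt => by
    linarith [gap i hi j hj hlt, (abs_le.1 (abs_blockwise_le hp hκ y hφ hi)).1,
      (abs_le.1 (abs_blockwise_le hp hκ y hφ hj)).2]
  have end_eq := (blockStart_add_le hp hκ le_rfl).antisymm
    (Nat.succ_le_of_lt (lt_blockStart_add hp hκ le_rfl))
  exact end_eq ▸ apply_prefix_add hp hκ y hφ ordered (supportEnd p) le_rfl x
    (end_eq ▸ Nat.lt_succ_of_le hx)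

end Blockwise

end Blocks

section Estimators

variable {Ω : Type*} {X : ℕ → Ω → ℕ} {φ : ℕ → (ℕ → ℝ) → ℕ → ℝ} {m n : ℕ} {ω : Ω}

/-- The estimator of the mass function obtained by applying `φ` to the vector of empirical
frequencies on `{0, …, max {X_0, …, X_{n-1}}}`. -/
def estimator (φ : ℕ → (ℕ → ℝ) → ℕ → ℝ) (X : ℕ → Ω → ℕ) (n : ℕ) (ω : Ω) : ℕ → ℝ :=
  φ (sampleLength X n ω) (empirical X n ω)

theorem empirical_eq_zero_of_sampleLength_le {x : ℕ} (hx : sampleLength X n ω ≤ x) :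
    empirical X n ω x = 0 :=
  empirical_eq_zero fun _ hi => ne_of_lt <| lt_of_lt_of_le
    (Nat.lt_succ_of_le (Finset.le_sup (f := fun i => X i ω) (Finset.mem_range.2 hi))) hx

theorem sampleLength_le (h : ∀ i, X i ω < m) : sampleLength X n ω ≤ m :=
  Nat.succ_le_of_lt ((Finset.sup_lt_iff ((Nat.zero_le _).trans_lt (h 0))).2 fun i _ => h i)

theorem estimator_truncate (X : ℕ → Ω → ℕ) : estimator truncate X = empirical X := by
  funext n ω x
  rcases Nat.lt_or_ge x (sampleLength X n ω) with hx | hx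
  · exact truncate_of_lt hx
  · exact (truncate_of_le hx).trans (empirical_eq_zero_of_sampleLength_le hx).symm

theorem IsBlockOperator.apply_eq_of_le (hφ : IsBlockOperator φ) {w : ℕ → ℝ} (hmn : m ≤ n)
    (hw : ∀ i, 0 ≤ w i) (hw0 : ∀ i, m ≤ i → w i = 0) : φ n w = φ m w := by
  obtain ⟨k, rfl⟩ := Nat.exists_eq_add_of_le hmn
  have apply_tail : φ k (fun i => w (m + i)) = fun _ => 0 := by
    simp only [hw0 _ (Nat.le_add_right m _), hφ.map_zero]
  rw [hφ.append _ _ _ fun i _ j _ => by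
    rw [apply_tail]; exact hφ.nonneg _ _ (fun i _ => hw i) _, apply_tail]
  funext x
  rw [juxtapose, ite_eq_left_iff]
  exact fun hx => (hφ.eq_zero_of_le _ _ _ (not_lt.1 hx)).symm

theorem estimator_eq (hφ : IsBlockOperator φ) (h : ∀ i, X i ω < m) :
    estimator φ X n ω = φ m (empirical X n ω) :=
  (hφ.apply_eq_of_le (sampleLength_le h) (empirical_nonneg X n ω)
    fun _ => empirical_eq_zero_of_sampleLength_le).symm

end Estimators

section LocalFluctuations

variable {p : ℕ → ℝ} {φ : ℕ → (ℕ → ℝ) → ℕ → ℝ}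

/-- The estimator as a function of the sample size `n` and of the value `y` of `√n (p̂_n - p)`, for
samples in the support of `p`. -/
def localEstimator (φ : ℕ → (ℕ → ℝ) → ℕ → ℝ) (p : ℕ → ℝ) (n : ℕ) (y : ℕ → ℝ) : ℕ → ℝ :=
  φ (supportEnd p + 1) fun i => p i + (√(n : ℝ))⁻¹ * y i

/-- The process `√n (q̂_n - q)` as a function of the value of `√n (p̂_n - p)`. -/
def localFluctuation (φ : ℕ → (ℕ → ℝ) → ℕ → ℝ) (p : ℕ → ℝ) : ℕ → (ℕ → ℝ) → ℕ → ℝ :=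
  mixingFluctuation p (localEstimator φ p)

/-- The limit of `localFluctuation φ p n` as `n → ∞`. The truncation only matters for sequences
that do not vanish outside the support of `p`. -/
def limitFluctuation (φ : ℕ → (ℕ → ℝ) → ℕ → ℝ) (p : ℕ → ℝ) (y : ℕ → ℝ) : ℕ → ℝ :=
  mixing (truncate (supportEnd p + 1) (blockwise φ p y))

theorem continuous_localFluctuation (hφ : IsBlockOperator φ) (n : ℕ) :
    Continuous (localFluctuation φ p n) := by
  have continuous_arg : Continuous fun (y : ℕ → ℝ) i => p i + (√(n : ℝ))⁻¹ * y i := by fun_prop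
  have continuous_mixing_localEstimator : Continuous fun y => mixing (localEstimator φ p n y) :=
    continuous_mixing.comp ((hφ.continuous _).comp continuous_arg)
  unfold localFluctuation mixingFluctuation
  fun_prop

theorem limitFluctuation_eq_zero_of_lt (y : ℕ → ℝ) {x : ℕ} (hx : supportEnd p < x) :
    limitFluctuation φ p y x = 0 :=
  mixing_eq_zero_of_le (fun _ => truncate_of_le) hx

variable (hp : IsDecreasingPMF p) (hκ : BddAbove {x | 0 < p x}) (hφ : IsBlockOperator φ)
include hp hκ hφ

theorem continuous_limitFluctuation : Continuous (limitFluctuation φ p) :=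
  continuous_mixing.comp
    ((isBlockOperator_truncate.continuous _).comp (continuous_blockwise hp hκ hφ))

theorem localFluctuation_eq_zero_of_lt (n : ℕ) (y : ℕ → ℝ) {x : ℕ} (hx : supportEnd p < x) :
    localFluctuation φ p n y x = 0 := by
  rw [localFluctuation, mixingFluctuation_eq]
  refine mixing_eq_zero_of_le (fun z hz => ?_) hx
  rw [localEstimator, hφ.eq_zero_of_le _ _ _ hz, hp.eq_zero_of_supportEnd_lt hκ hz, sub_zero,
    mul_zero]

theorem apply_eq_self : φ (supportEnd p + 1) p = p := by
  obtain ⟨δ, hδ, apply_eq⟩ := exists_apply_add_eq_add_blockwise hp hκ hφ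
  funext x
  rcases le_or_gt x (supportEnd p) with hx | hx
  · have apply_add_zero := apply_eq (fun _ => 0) (by simpa using hδ.le) x hx
    have blockwise_zero := abs_blockwise_le hp hκ (fun _ => 0) hφ hx
    simp only [abs_zero, Finset.sum_const_zero, mul_zero, abs_nonpos_iff] at blockwise_zero
    simpa only [blockwise_zero, add_zero] using apply_add_zero
  · rw [hφ.eq_zero_of_le _ _ _ hx, hp.eq_zero_of_supportEnd_lt hκ hx]

theorem abs_localFluctuation_le (n : ℕ) (y : ℕ → ℝ) (x : ℕ) :
    |localFluctuation φ p n y x| ≤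
      4 * ((supportEnd p : ℝ) + 1) * ∑ i ∈ Finset.range (supportEnd p + 1), |y i| := by
  have sum_nonneg : 0 ≤ ∑ i ∈ Finset.range (supportEnd p + 1), |y i| :=
    Finset.sum_nonneg fun _ _ => abs_nonneg _
  rcases le_or_gt x (supportEnd p) with hx | hx
  · have abs_le : ∀ z, |√(n : ℝ) * (localEstimator φ p n y z - p z)| ≤
        2 * ∑ i ∈ Finset.range (supportEnd p + 1), |y i| := fun z => by
      have lipschitz := hφ.lipschitz (supportEnd p + 1) (fun i => p i + (√(n : ℝ))⁻¹ * y i) p z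
      simp only [apply_eq_self hp hκ hφ, add_sub_cancel_left, abs_mul, ← Finset.mul_sum]
        at lipschitz
      rw [abs_mul]
      refine (mul_le_mul_of_nonneg_left lipschitz (abs_nonneg _)).trans ?_
      rw [mul_left_comm, ← mul_assoc |√(n : ℝ)|, ← abs_mul]
      refine mul_le_mul_of_nonneg_left (mul_le_of_le_one_left sum_nonneg ?_) zero_le_two
      exact (abs_of_nonneg (by positivity)).trans_le mul_inv_le_one
    rw [localFluctuation, mixingFluctuation_eq]
    calc |mixing (fun z => √(n : ℝ) * (localEstimator φ p n y z - p z)) x|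
        ≤ 2 * ((x : ℝ) + 1) * (2 * ∑ i ∈ Finset.range (supportEnd p + 1), |y i|) :=
          abs_mixing_le abs_le x
      _ ≤ 2 * ((supportEnd p : ℝ) + 1) * (2 * ∑ i ∈ Finset.range (supportEnd p + 1), |y i|) := by
          gcongr
      _ = 4 * ((supportEnd p : ℝ) + 1) * ∑ i ∈ Finset.range (supportEnd p + 1), |y i| := by ring
  · rw [localFluctuation_eq_zero_of_lt hp hκ hφ n y hx, abs_zero]
    positivity

theorem eventually_localFluctuation_eq (y₀ : ℕ → ℝ) :
    ∀ᶠ q : ℕ × (ℕ → ℝ) in atTop ×ˢ 𝓝 y₀,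
      localFluctuation φ p q.1 q.2 = limitFluctuation φ p q.2 := by
  obtain ⟨δ, hδ, apply_eq⟩ := exists_apply_add_eq_add_blockwise hp hκ hφ
  have tendsto_sum : Tendsto (fun q : ℕ × (ℕ → ℝ) =>
      ∑ i ∈ Finset.range (supportEnd p + 1), |(√(q.1 : ℝ))⁻¹ * q.2 i|) (atTop ×ˢ 𝓝 y₀)
      (𝓝 (∑ i ∈ Finset.range (supportEnd p + 1), |0 * y₀ i|)) :=
    tendsto_finsetSum _ fun i _ => ((tendsto_inv_atTop_zero.comp
      (Real.tendsto_sqrt_atTop.comp tendsto_natCast_atTop_atTop)).comp tendsto_fst).mul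
        (((continuous_apply i).tendsto y₀).comp tendsto_snd) |>.abs
  simp only [zero_mul, abs_zero, Finset.sum_const_zero] at tendsto_sum
  filter_upwards [tendsto_sum.eventually (eventually_lt_nhds hδ),
    tendsto_fst.eventually (eventually_gt_atTop 0)] with q small q_pos
  have sqrt_pos : 0 < √(q.1 : ℝ) := Real.sqrt_pos.2 (by exact_mod_cast q_pos)
  rw [localFluctuation, mixingFluctuation_eq, limitFluctuation]
  congr 1
  funext x
  rcases le_or_gt x (supportEnd p) with hx | hx
  · rw [localEstimator, apply_eq _ small.le x hx, truncate_of_lt (Nat.lt_succ_of_le hx),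
      blockwise_const_mul _ hφ (inv_nonneg.2 sqrt_pos.le), add_sub_cancel_left,
      mul_inv_cancel_left₀ sqrt_pos.ne']
  · rw [localEstimator, hφ.eq_zero_of_le _ _ _ hx, hp.eq_zero_of_supportEnd_lt hκ hx,
      truncate_of_le hx, sub_zero, mul_zero]

section Probability

variable {Ω : Type*} [MeasurableSpace Ω] {P : Measure Ω} [IsProbabilityMeasure P]

theorem IsSample.ae_mixingFluctuation_estimator_eq {X : ℕ → Ω → ℕ} (hX : IsSample p X P) :
    ∀ᵐ ω ∂P, ∀ n, mixingFluctuation p (estimator φ X) n ω =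
      localFluctuation φ p n (empiricalFluctuation p X n ω) := by
  filter_upwards [hX.ae_le_supportEnd hp hκ] with ω hω n
  rw [localFluctuation, mixingFluctuation_eq, mixingFluctuation_eq]
  rcases Nat.eq_zero_or_pos n with rfl | hn
  · simp
  have sqrt_ne_zero : √(n : ℝ) ≠ 0 := (Real.sqrt_pos.2 (by exact_mod_cast hn)).ne'
  have empirical_eq : (fun i => p i + (√(n : ℝ))⁻¹ * empiricalFluctuation p X n ω i) =
      empirical X n ω := funext fun i => by
    rw [empiricalFluctuation, inv_mul_cancel_left₀ sqrt_ne_zero, add_sub_cancel]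
  rw [localEstimator, empirical_eq, estimator_eq hφ fun i => Nat.lt_succ_of_le (hω i)]

omit hφ in
theorem IsLimitGaussian.ae_limitFluctuation_eq {Y : ℕ → Ω → ℝ} (hY : IsLimitGaussian p Y P) :
    ∀ᵐ ω ∂P, limitFluctuation φ p (fun x => Y x ω) = mixing (blockwise φ p fun x => Y x ω) := by
  filter_upwards [hY.ae_eq_zero_of_supportEnd_lt hp hκ] with ω hω
  rw [limitFluctuation]
  congr 1
  funext x
  rcases le_or_gt x (supportEnd p) with hx | hx
  · exact truncate_of_lt (Nat.lt_succ_of_le hx)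
  · rw [truncate_of_le hx, blockwise_of_lt hp hκ _ hx, hω x hx]

end Probability

end LocalFluctuations

/-! ### Finitely supported sequences in `ℓ_k` -/

section Ell

variable (k : ℝ≥0∞) {m : ℕ} {w : ℕ → ℝ}

theorem memℓp_of_eq_zero (hw : ∀ x, m ≤ x → w x = 0) : Memℓp w k :=
  (memℓp_zero ((Set.finite_lt_nat m).subset fun x hx =>
    not_le.1 fun h => hx (hw x h))).of_exponent_ge zero_le

theorem toEll_eq_sum (hw : ∀ x, m ≤ x → w x = 0) :
    toEll k w = ∑ x ∈ Finset.range m, lp.single k x (w x) := by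
  rw [toEll, dif_pos (memℓp_of_eq_zero k hw)]
  ext x
  simp only [lp.coeFn_sum, Finset.sum_apply, lp.coeFn_single, Finset.sum_pi_single,
    Finset.mem_range]
  split_ifs with hx
  · rfl
  · exact hw x (not_lt.1 hx)

variable [hk : Fact (1 ≤ k)]

theorem continuous_sum_single (m : ℕ) :
    Continuous fun w : ℕ → ℝ => ∑ x ∈ Finset.range m, (lp.single k x (w x) : Ell k) :=
  continuous_finsetSum _ fun x _ =>
    (AddMonoidHomClass.isometry_of_norm (lp.singleAddMonoidHom (E := fun _ : ℕ => ℝ) k x) fun a =>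
      lp.norm_single (E := fun _ : ℕ => ℝ) (zero_lt_one.trans_le hk.out) x a).continuous.comp
        (continuous_apply x)

theorem norm_toEll_le (hw : ∀ x, m ≤ x → w x = 0) :
    ‖toEll k w‖ ≤ ∑ x ∈ Finset.range m, |w x| := by
  rw [toEll_eq_sum k hw]
  refine (norm_sum_le _ _).trans (Finset.sum_le_sum fun x _ => ?_)
  rw [lp.norm_single (zero_lt_one.trans_le hk.out), Real.norm_eq_abs]

end Ell

/-! ### The Hellinger statistic -/

/-- One term `|√a - √b|²` of the Hellinger distance, with the principal complex square root. -/
def hellingerTerm (a b : ℝ) : ℝ := ‖(a : ℂ) ^ (1 / 2 : ℂ) - (b : ℂ) ^ (1 / 2 : ℂ)‖ ^ 2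

theorem hellingerTerm_self (a : ℝ) : hellingerTerm a a = 0 := by
  rw [hellingerTerm, sub_self, norm_zero, zero_pow two_ne_zero]

theorem hellingerTerm_of_nonneg {a b : ℝ} (ha : 0 ≤ a) (hb : 0 ≤ b) :
    hellingerTerm a b = (√a - √b) ^ 2 := by
  have cpow_half : ∀ t : ℝ, 0 ≤ t → (t : ℂ) ^ (1 / 2 : ℂ) = ((√t : ℝ) : ℂ) := fun t ht => by
    rw [Real.sqrt_eq_rpow, Complex.ofReal_cpow ht]
    norm_num
  rw [hellingerTerm, cpow_half a ha, cpow_half b hb, ← Complex.ofReal_sub, Complex.norm_real,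
    Real.norm_eq_abs, sq_abs]

theorem norm_cpow_half_sq (a : ℝ) : ‖(a : ℂ) ^ (1 / 2 : ℂ)‖ ^ 2 = |a| := by
  rw [show (1 / 2 : ℂ) = ((1 / 2 : ℝ) : ℂ) by norm_num, Complex.norm_cpow_real,
    ← Real.sqrt_eq_rpow, Real.sq_sqrt (norm_nonneg _), Complex.norm_real, Real.norm_eq_abs]

theorem hellingerTerm_zero_right (a : ℝ) : hellingerTerm a 0 = |a| := by
  rw [hellingerTerm, Complex.ofReal_zero, Complex.zero_cpow (by norm_num), sub_zero,
    norm_cpow_half_sq]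

theorem hellingerTerm_le_two_mul (a b : ℝ) : hellingerTerm a b ≤ 2 * (|a| + |b|) := by
  rw [hellingerTerm, ← norm_cpow_half_sq a, ← norm_cpow_half_sq b]
  refine (pow_le_pow_left₀ (norm_nonneg _) (norm_sub_le _ _) 2).trans add_sq_le

theorem sub_eq_sqrt_sub_mul_sqrt_add {a b : ℝ} (ha : 0 ≤ a) (hb : 0 ≤ b) :
    a - b = (√a - √b) * (√a + √b) := by
  linear_combination Real.sq_sqrt hb - Real.sq_sqrt ha

theorem hellingerTerm_le {a b : ℝ} (hb : 0 < b) : hellingerTerm a b ≤ 2 * ((a - b) ^ 2 / b) := by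
  rcases le_or_gt 0 a with ha | ha
  · have le_sq : b ≤ (√a + √b) ^ 2 := by
      rw [← Real.sqrt_le_left (by positivity)]
      exact le_add_of_nonneg_left (Real.sqrt_nonneg a)
    calc hellingerTerm a b = (√a - √b) ^ 2 := hellingerTerm_of_nonneg ha hb.le
      _ ≤ (a - b) ^ 2 / b := by
          rw [le_div_iff₀ hb, sub_eq_sqrt_sub_mul_sqrt_add ha hb.le, mul_pow]
          exact mul_le_mul_of_nonneg_left le_sq (sq_nonneg _)
      _ ≤ 2 * ((a - b) ^ 2 / b) := le_mul_of_one_le_left (by positivity) one_le_two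
  · refine (hellingerTerm_le_two_mul a b).trans ?_
    rw [abs_of_neg ha, abs_of_pos hb]
    gcongr
    rw [le_div_iff₀ hb]
    nlinarith

section HellingerTermLimit

variable {ι : Type*} {l : Filter ι} {N : ι → ℕ} {z : ι → ℝ} {q z₀ : ℝ}

theorem tendsto_sqrt_natCast_atTop (hN : Tendsto N l atTop) :
    Tendsto (fun i => √(N i : ℝ)) l atTop :=
  Real.tendsto_sqrt_atTop.comp (tendsto_natCast_atTop_atTop.comp hN)

theorem tendsto_mul_hellingerTerm_of_pos (hq : 0 < q) (hN : Tendsto N l atTop)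
    (hz : Tendsto z l (𝓝 z₀)) :
    Tendsto (fun i => (N i : ℝ) * (2⁻¹ * hellingerTerm (q + (√(N i : ℝ))⁻¹ * z i) q)) l
      (𝓝 (8⁻¹ * (z₀ ^ 2 / q))) := by
  have tendsto_q : Tendsto (fun i => q + (√(N i : ℝ))⁻¹ * z i) l (𝓝 q) := by
    simpa only [Pi.inv_apply, zero_mul, add_zero] using
      ((tendsto_sqrt_natCast_atTop hN).inv_tendsto_atTop.mul hz).const_add q
  have tendsto_sq : Tendsto (fun i => 2⁻¹ * (z i / (√(q + (√(N i : ℝ))⁻¹ * z i) + √q)) ^ 2) l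
      (𝓝 (2⁻¹ * (z₀ / (√q + √q)) ^ 2)) :=
    ((hz.div (((Real.continuous_sqrt.tendsto q).comp tendsto_q).add tendsto_const_nhds)
      (by positivity)).pow 2).const_mul _
  have limit_eq : 2⁻¹ * (z₀ / (√q + √q)) ^ 2 = 8⁻¹ * (z₀ ^ 2 / q) := by
    rw [div_pow, ← two_mul, mul_pow, Real.sq_sqrt hq.le]
    field_simp
    ring
  rw [limit_eq] at tendsto_sq
  refine tendsto_sq.congr' ?_
  filter_upwards [tendsto_q.eventually (lt_mem_nhds hq),
    (tendsto_sqrt_natCast_atTop hN).eventually_gt_atTop 0] with i a_pos sqrt_N_pos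
  have z_eq := sub_eq_sqrt_sub_mul_sqrt_add a_pos.le hq.le
  rw [add_sub_cancel_left, inv_mul_eq_iff_eq_mul₀ sqrt_N_pos.ne'] at z_eq
  rw [hellingerTerm_of_nonneg a_pos.le hq.le, mul_left_comm]
  nth_rw 1 [z_eq]
  rw [← mul_assoc, mul_div_cancel_right₀ _ (by positivity), mul_pow,
    Real.sq_sqrt (Nat.cast_nonneg _)]

theorem tendsto_mul_hellingerTerm_zero_right (hN : Tendsto N l atTop) (hz : Tendsto z l (𝓝 z₀))
    (h0 : z₀ ≠ 0) :
    Tendsto (fun i => (N i : ℝ) * (2⁻¹ * hellingerTerm ((√(N i : ℝ))⁻¹ * z i) 0)) l atTop := by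
  refine ((tendsto_sqrt_natCast_atTop hN).atTop_mul_pos (by positivity : 0 < 2⁻¹ * |z₀|)
    (hz.abs.const_mul _)).congr' ?_
  filter_upwards [(tendsto_sqrt_natCast_atTop hN).eventually_gt_atTop 0] with i sqrt_N_pos
  rw [hellingerTerm_zero_right, abs_mul, abs_of_pos (inv_pos.2 sqrt_N_pos)]
  nth_rw 2 [← Real.mul_self_sqrt (Nat.cast_nonneg (N i))]
  field_simp

theorem tendsto_mul_ofReal_hellingerTerm (hq : 0 ≤ q) (hN : Tendsto N l atTop)
    (hz : Tendsto z l (𝓝 z₀)) (h0 : q = 0 → z₀ ≠ 0 ∨ ∀ᶠ i in l, z i = 0) :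
    Tendsto (fun i =>
        ENNReal.ofReal ((N i : ℝ) * (2⁻¹ * hellingerTerm (q + (√(N i : ℝ))⁻¹ * z i) q))) l
      (𝓝 (8⁻¹ * (ENNReal.ofReal (z₀ ^ 2) / ENNReal.ofReal q))) := by
  rcases hq.eq_or_lt with rfl | hq
  · simp only [zero_add, ENNReal.ofReal_zero]
    rcases eq_or_ne z₀ 0 with rfl | hz₀
    · rw [zero_pow two_ne_zero, ENNReal.ofReal_zero, ENNReal.zero_div, mul_zero]
      refine tendsto_const_nhds.congr' ?_
      filter_upwards [(h0 rfl).resolve_left (by simp)] with i hi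
      rw [hi, mul_zero, hellingerTerm_self, mul_zero, mul_zero, ENNReal.ofReal_zero]
    · have sq_ne_zero : ENNReal.ofReal (z₀ ^ 2) ≠ 0 := (ENNReal.ofReal_pos.2 (by positivity)).ne'
      rw [ENNReal.div_zero sq_ne_zero, ENNReal.mul_top (by simp)]
      exact ENNReal.tendsto_ofReal_atTop.comp (tendsto_mul_hellingerTerm_zero_right hN hz hz₀)
  · rw [← ENNReal.ofReal_div_of_pos hq, ← ENNReal.ofReal_ofNat 8,
      ← ENNReal.ofReal_inv_of_pos (by norm_num), ← ENNReal.ofReal_mul (by norm_num)]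
    exact ENNReal.tendsto_ofReal (tendsto_mul_hellingerTerm_of_pos hq hN hz)

end HellingerTermLimit

section HellingerStatistic

variable {p : ℕ → ℝ} {n : ℕ}

/-- The statistic `n H²(q̂_n, q)`, where `q` is the mixing distribution of `p`, as a function of
the sample size `n` and of the value `v` of `√n (q̂_n - q)`. -/
def hellingerStatistic (p : ℕ → ℝ) (n : ℕ) (v : ℕ → ℝ) : ℝ≥0∞ :=
  n * hellingerSq (fun x => mixing p x + (√(n : ℝ))⁻¹ * v x) (mixing p)

theorem natCast_mul_hellingerSq_eq {Ω : Type*} (phat : ℕ → Ω → ℕ → ℝ) (n : ℕ) (ω : Ω) :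
    n * hellingerSq (mixing (phat n ω)) (mixing p) =
      hellingerStatistic p n (mixingFluctuation p phat n ω) := by
  rcases n.eq_zero_or_pos with rfl | hn
  · rw [hellingerStatistic, Nat.cast_zero, zero_mul, zero_mul]
  · have sqrt_ne_zero : √(n : ℝ) ≠ 0 := (Real.sqrt_pos.2 (Nat.cast_pos.2 hn)).ne'
    simp only [hellingerStatistic, mixingFluctuation, inv_mul_cancel_left₀ sqrt_ne_zero,
      add_sub_cancel]

theorem measurable_hellingerStatistic (p : ℕ → ℝ) (n : ℕ) :
    Measurable (hellingerStatistic p n) := by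
  unfold hellingerStatistic hellingerSq
  fun_prop

theorem hellingerStatistic_eq_sum {v : ℕ → ℝ} (hv : ∀ x, supportEnd p < x → v x = 0) :
    hellingerStatistic p n v = ∑ x ∈ Finset.range (supportEnd p + 1), ENNReal.ofReal
      ((n : ℝ) * (2⁻¹ * hellingerTerm (mixing p x + (√(n : ℝ))⁻¹ * v x) (mixing p x))) := by
  rw [hellingerStatistic, hellingerSq, tsum_eq_sum (s := Finset.range (supportEnd p + 1)),
    Finset.mul_sum, Finset.mul_sum]
  · refine Finset.sum_congr rfl fun x _ => ?_
    rw [ENNReal.ofReal_mul (Nat.cast_nonneg _), ENNReal.ofReal_mul (by norm_num),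
      ENNReal.ofReal_natCast, ENNReal.ofReal_inv_of_pos (by norm_num), ENNReal.ofReal_ofNat]
    rfl
  · intro x hx
    simp only [hv x (by simpa using hx), mul_zero, add_zero, sub_self, norm_zero,
      zero_pow two_ne_zero, ENNReal.ofReal_zero]

variable (hq : ∀ x, 0 ≤ mixing p x)
include hq

theorem tendsto_hellingerStatistic {ι : Type*} {l : Filter ι} {N : ι → ℕ} {v : ι → ℕ → ℝ}
    {v₀ : ℕ → ℝ} (hN : Tendsto N l atTop) (hv : Tendsto v l (𝓝 v₀))
    (hv0 : ∀ i x, supportEnd p < x → v i x = 0)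
    (h0 : ∀ x ≤ supportEnd p, mixing p x = 0 → v₀ x ≠ 0 ∨ ∀ᶠ i in l, v i x = 0) :
    Tendsto (fun i => hellingerStatistic p (N i) (v i)) l (𝓝 (weightedSq p v₀)) := by
  simp only [hellingerStatistic_eq_sum (hv0 _), weightedSq, Finset.mul_sum]
  exact tendsto_finsetSum _ fun x hx => tendsto_mul_ofReal_hellingerTerm (hq x) hN
    (tendsto_pi_nhds.1 hv x) (h0 x (Finset.mem_range_succ_iff.1 hx))

theorem hellingerStatistic_le {v : ℕ → ℝ} (hv : ∀ x, supportEnd p < x → v x = 0) :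
    hellingerStatistic p n v ≤ 8 * weightedSq p v := by
  rw [hellingerStatistic_eq_sum hv, weightedSq, ← mul_assoc,
    ENNReal.mul_inv_cancel (by norm_num) (by norm_num), one_mul]
  refine Finset.sum_le_sum fun x _ => ?_
  rcases (hq x).eq_or_lt with hqx | hqx
  · rw [← hqx, zero_add, hellingerTerm_zero_right]
    rcases eq_or_ne (v x) 0 with hvx | hvx
    · simp [hvx]
    · have sq_ne_zero : ENNReal.ofReal (v x ^ 2) ≠ 0 := (ENNReal.ofReal_pos.2 (by positivity)).ne'
      rw [ENNReal.ofReal_zero, ENNReal.div_zero sq_ne_zero]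
      exact le_top
  · rw [← ENNReal.ofReal_div_of_pos hqx]
    refine ENNReal.ofReal_le_ofReal ?_
    calc (n : ℝ) * (2⁻¹ * hellingerTerm (mixing p x + (√(n : ℝ))⁻¹ * v x) (mixing p x))
        ≤ n * (2⁻¹ * (2 * (((√(n : ℝ))⁻¹ * v x) ^ 2 / mixing p x))) := by
          have term_le := hellingerTerm_le (a := mixing p x + (√(n : ℝ))⁻¹ * v x) hqx
          rw [add_sub_cancel_left] at term_le
          gcongr
      _ = (n : ℝ) * (n : ℝ)⁻¹ * (v x ^ 2 / mixing p x) := by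
          rw [mul_pow, inv_pow, Real.sq_sqrt (Nat.cast_nonneg _)]
          ring
      _ ≤ v x ^ 2 / mixing p x := mul_le_of_le_one_left (by positivity) mul_inv_le_one

end HellingerStatistic

/-! ### Ties of the limit process -/

section AverageContrast

variable {p : ℕ → ℝ} {s t : Finset ℕ}

/-- The coefficients of the linear form `#t * ∑ i ∈ s, y i - #s * ∑ i ∈ t, y i`, which compares the
averages of `y` over the disjoint sets `s` and `t`. -/
def averageContrast (s t : Finset ℕ) : ℕ → ℝ := fun i => if i ∈ s then t.card else -s.card

theorem sum_averageContrast_mul (hst : Disjoint s t) (y : ℕ → ℝ) :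
    ∑ i ∈ s ∪ t, averageContrast s t i * y i =
      t.card * ∑ i ∈ s, y i - s.card * ∑ i ∈ t, y i := by
  have sum_left : ∑ i ∈ s, averageContrast s t i * y i = t.card * ∑ i ∈ s, y i := by
    rw [Finset.mul_sum]
    exact Finset.sum_congr rfl fun i hi => by rw [averageContrast, if_pos hi]
  have sum_right : ∑ i ∈ t, averageContrast s t i * y i = -(s.card * ∑ i ∈ t, y i) := by
    rw [Finset.mul_sum, ← Finset.sum_neg_distrib]
    exact Finset.sum_congr rfl fun i hi => by
      rw [averageContrast, if_neg (Finset.disjoint_right.1 hst hi), neg_mul]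
  rw [Finset.sum_union hst, sum_left, sum_right, sub_eq_add_neg]

theorem covarianceForm_averageContrast_pos (hst : Disjoint s t) (hs : s.Nonempty)
    (ht : t.Nonempty) {a : ℝ} (ha : 0 < a) (hpa : ∀ i ∈ s ∪ t, p i = a) :
    0 < covarianceForm p (s ∪ t) (averageContrast s t) := by
  have sum_eq_zero : ∑ i ∈ s ∪ t, averageContrast s t i * p i = 0 := by
    rw [sum_averageContrast_mul hst,
      Finset.sum_congr rfl fun i hi => hpa i (Finset.mem_union_left t hi),
      Finset.sum_congr rfl fun i hi => hpa i (Finset.mem_union_right s hi)]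
    simp only [Finset.sum_const, nsmul_eq_mul]
    ring
  obtain ⟨i, hi⟩ := hs
  rw [covarianceForm_eq, sum_eq_zero, zero_pow two_ne_zero, sub_zero]
  refine Finset.sum_pos' (fun z hz => by rw [hpa z hz]; positivity)
    ⟨i, Finset.mem_union_left t hi, ?_⟩
  rw [hpa i (Finset.mem_union_left t hi), averageContrast, if_pos hi]
  positivity

end AverageContrast

theorem IsBlockOperator.mul_apply_zero_le_sum_of_flat {φ : ℕ → (ℕ → ℝ) → ℕ → ℝ}
    (hφ : IsBlockOperator φ) {m : ℕ} {w : ℕ → ℝ}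
    (flat : ∀ j < m, φ (m + 1) w (j + 1) = φ (m + 1) w j) :
    m * w 0 ≤ ∑ i ∈ Finset.range m, w (i + 1) := by
  have apply_eq : ∀ i ∈ Finset.range (m + 1), φ (m + 1) w i = φ (m + 1) w 0 := fun i hi =>
    Nat.le_induction (P := fun i _ => i ≤ m → φ (m + 1) w i = φ (m + 1) w 0) (fun _ => rfl)
      (fun j _ ih hj => (flat j hj).trans (ih (Nat.le_of_succ_le hj))) i (Nat.zero_le i)
      (Finset.mem_range_succ_iff.1 hi)
  have sum_eq := hφ.sum_eq (m + 1) w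
  rw [Finset.sum_congr rfl apply_eq, Finset.sum_const, Finset.card_range, nsmul_eq_mul,
    Finset.sum_range_succ', Nat.cast_succ] at sum_eq
  have mul_le := mul_le_mul_of_nonneg_left (hφ.apply_zero_le (m + 1) w m.succ_pos)
    (Nat.cast_add_one_pos m).le
  linarith

section Ties

variable {Ω : Type*} [MeasurableSpace Ω] {P : Measure Ω} [IsProbabilityMeasure P] {p : ℕ → ℝ}
  {Y : ℕ → Ω → ℝ}

theorem IsLimitGaussian.not_ae_sum_mul_nonpos (hY : IsLimitGaussian p Y P) {s : Finset ℕ}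
    {c : ℕ → ℝ} (h : 0 < covarianceForm p s c) : ¬ ∀ᵐ ω ∂P, ∑ i ∈ s, c i * Y i ω ≤ 0 := by
  intro sum_nonpos
  have integrable_term : ∀ i ∈ s, Integrable (fun ω => c i * Y i ω) P := fun i _ =>
    ((hY.memLp_two i).integrable one_le_two).const_mul _
  have integral_eq_zero : ∫ ω, -∑ i ∈ s, c i * Y i ω ∂P = 0 := by
    rw [integral_neg, integral_finsetSum _ integrable_term]
    simp only [integral_const_mul, hY.mean, mul_zero, Finset.sum_const_zero, neg_zero]
  have sum_eq_zero := (integral_eq_zero_iff_of_nonneg_ae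
    (sum_nonpos.mono fun _ hω => neg_nonneg.2 hω)
    (integrable_finsetSum s integrable_term).neg).1 integral_eq_zero
  obtain ⟨ω, eq_zero, ne_zero⟩ := (sum_eq_zero.and (hY.ae_sum_mul_ne_zero h)).exists
  exact ne_zero (neg_eq_zero.1 eq_zero)

variable (hp : IsDecreasingPMF p) (hκ : BddAbove {x | 0 < p x})
include hp hκ

theorem IsLimitGaussian.ae_hasDistinctAverages (hY : IsLimitGaussian p Y P) {x : ℕ}
    (hx : x ≤ supportEnd p) :
    ∀ᵐ ω ∂P, HasDistinctAverages (blockLength p x) fun i => Y (blockStart p x + i) ω := by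
  refine ae_all_iff.2 fun s => eventually_imp_distrib_left.2 fun hs => ae_all_iff.2 fun t =>
    eventually_imp_distrib_left.2 fun ht => eventually_imp_distrib_left.2 fun hst =>
    eventually_imp_distrib_left.2 fun hs' => eventually_imp_distrib_left.2 fun ht' => ?_
  let shift := addLeftEmbedding (blockStart p x)
  have disjoint_shift : Disjoint (s.map shift) (t.map shift) := (Finset.disjoint_map _).2 hst
  have apply_eq : ∀ i ∈ s.map shift ∪ t.map shift, p i = p x := fun i hi => by
    rw [← Finset.map_union, Finset.mem_map] at hi
    obtain ⟨j, hj, rfl⟩ := hi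
    exact apply_blockStart_add hp hκ hx (Finset.mem_range.1 (Finset.union_subset hs ht hj))
  filter_upwards [hY.ae_sum_mul_ne_zero (covarianceForm_averageContrast_pos disjoint_shift
    hs'.map ht'.map ((hp.pos_iff_le_supportEnd hκ).2 hx) apply_eq)] with ω hω
  simpa only [sum_averageContrast_mul disjoint_shift, sub_ne_zero, Finset.sum_map,
    Finset.card_map, shift, addLeftEmbedding_apply] using hω

theorem lt_blockLength_of_mixing_eq_zero {x : ℕ} (hx : x ≤ supportEnd p)
    (hq : mixing p x = 0) : x - blockStart p x + 1 < blockLength p x := by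
  have block_succ := (eq_iff_mem_block hp hκ hx (x + 1)).1 (mixing_eq_zero_iff.1 hq)
  have start_le := blockStart_le hp hκ hx
  omega

theorem limitFluctuation_blockStart_add_eq_zero_iff (φ : ℕ → (ℕ → ℝ) → ℕ → ℝ) (y : ℕ → ℝ) {x j : ℕ}
    (hx : x ≤ supportEnd p) (hj : j + 1 < blockLength p x) :
    limitFluctuation φ p y (blockStart p x + j) = 0 ↔
      φ (blockLength p x) (fun i => y (blockStart p x + i)) (j + 1) =
        φ (blockLength p x) (fun i => y (blockStart p x + i)) j := by
  have end_le := blockStart_add_le hp hκ hx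
  rw [limitFluctuation, mixing_eq_zero_iff, add_assoc, truncate_of_lt (by omega),
    truncate_of_lt (by omega), blockwise_blockStart_add hp hκ y hx hj,
    blockwise_blockStart_add hp hκ y hx (by omega)]

variable {φ : ℕ → (ℕ → ℝ) → ℕ → ℝ} (hφ : IsBlockOperator φ)
include hφ

theorem IsLimitGaussian.ae_limitFluctuation_ne_zero_or (hY : IsLimitGaussian p Y P) :
    ∀ᵐ ω ∂P, ∀ x ≤ supportEnd p, mixing p x = 0 →
      limitFluctuation φ p (fun z => Y z ω) x ≠ 0 ∨
        ∀ᶠ y in 𝓝 (fun z => Y z ω), limitFluctuation φ p y x = 0 := by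
  refine ae_all_iff.2 fun x => eventually_imp_distrib_left.2 fun hx =>
    eventually_imp_distrib_left.2 fun hq => ?_
  filter_upwards [hY.ae_hasDistinctAverages hp hκ hx] with ω hω
  have hj := lt_blockLength_of_mixing_eq_zero hp hκ hx hq
  have eq_zero_iff := fun y => limitFluctuation_blockStart_add_eq_zero_iff hp hκ φ y hx hj
  simp only [Nat.add_sub_cancel' (blockStart_le hp hκ hx)] at eq_zero_iff
  simp only [ne_eq, eq_zero_iff]
  have continuous_block : Continuous fun (y : ℕ → ℝ) i => y (blockStart p x + i) := by fun_prop
  exact (hφ.ne_or_eventually_eq _ _ hω _ hj).imp_right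
    (continuous_block.tendsto fun i => Y i ω).eventually

theorem IsLimitGaussian.not_ae_limitFluctuation_eq_zero (hY : IsLimitGaussian p Y P) {x : ℕ}
    (hx : x ≤ supportEnd p) (hq : mixing p x = 0) :
    ¬ ∀ᵐ ω ∂P, ∀ z ≤ supportEnd p, mixing p z = 0 →
      limitFluctuation φ p (fun i => Y i ω) z = 0 := by
  obtain ⟨m, length_eq⟩ : ∃ m, blockLength p x = m + 1 :=
    Nat.exists_eq_add_one.2 (Nat.zero_lt_of_lt (lt_blockLength_of_mixing_eq_zero hp hκ hx hq))
  have m_pos : 0 < m := by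
    have := lt_blockLength_of_mixing_eq_zero hp hκ hx hq
    omega
  have apply_eq : ∀ j < m + 1, p (blockStart p x + j) = p x := fun j hj =>
    apply_blockStart_add hp hκ hx (length_eq ▸ hj)
  have end_le := blockStart_add_le hp hκ hx
  set r := blockStart p x
  have disjoint : Disjoint {r} (Finset.Ico (r + 1) (r + 1 + m)) := by simp
  have covariance_pos := covarianceForm_averageContrast_pos (p := p) disjoint
    (Finset.singleton_nonempty r) (Finset.nonempty_Ico.2 (by omega))
    ((hp.pos_iff_le_supportEnd hκ).2 hx) fun i hi => by
      rw [Finset.mem_union, Finset.mem_singleton, Finset.mem_Ico] at hi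
      rw [← apply_eq (i - r) (by omega), Nat.add_sub_cancel' (by omega)]
  refine fun flat => hY.not_ae_sum_mul_nonpos covariance_pos (flat.mono fun ω hω => ?_)
  have flat_block : ∀ j < m, φ (m + 1) (fun i => Y (r + i) ω) (j + 1) =
      φ (m + 1) (fun i => Y (r + i) ω) j := fun j hj => by
    rw [← length_eq, ← limitFluctuation_blockStart_add_eq_zero_iff hp hκ φ (fun i => Y i ω) hx
      (by omega)]
    refine hω (r + j) (by omega) (mixing_eq_zero_iff.2 ?_)
    rw [add_assoc, apply_eq (j + 1) (by omega), apply_eq j (by omega)]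
  have mul_le := hφ.mul_apply_zero_le_sum_of_flat flat_block
  rw [sum_averageContrast_mul disjoint, Finset.sum_Ico_eq_sum_range, Nat.add_sub_cancel_left]
  simpa [add_assoc, add_comm 1] using mul_le

end Ties

section WeightedSq

variable {p : ℕ → ℝ}

theorem measurable_weightedSq (p : ℕ → ℝ) : Measurable (weightedSq p) := by
  unfold weightedSq
  exact (Finset.measurable_fun_sum _ fun x _ =>
    ((measurable_pi_apply x).pow_const 2).ennreal_ofReal.div_const _).const_mul _

theorem weightedSq_ne_top_iff (hq : ∀ x, 0 ≤ mixing p x) {v : ℕ → ℝ} :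
    weightedSq p v ≠ ⊤ ↔ ∀ x ≤ supportEnd p, mixing p x = 0 → v x = 0 := by
  have ofReal_sq_div_eq_top : ∀ x, ENNReal.ofReal (v x ^ 2) / ENNReal.ofReal (mixing p x) = ⊤ ↔
      mixing p x = 0 ∧ v x ≠ 0 := fun x => by
    simp [ENNReal.div_eq_top, (hq x).ge_iff_eq', (sq_nonneg (v x)).ge_iff_eq', and_comm]
  have weightedSq_eq_top : weightedSq p v = ⊤ ↔
      ∃ x ≤ supportEnd p, mixing p x = 0 ∧ v x ≠ 0 := by
    simp [weightedSq, ENNReal.mul_eq_top, ofReal_sq_div_eq_top]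
  rw [ne_eq, weightedSq_eq_top]
  push Not
  rfl

theorem weightedSq_le_enorm_sq_mul {v : ℕ → ℝ} {c : ℝ} (hv : ∀ x, |v x| ≤ c) :
    weightedSq p v ≤ ‖c‖ₑ ^ 2 * weightedSq p 1 := by
  rw [weightedSq, weightedSq, mul_left_comm, Finset.mul_sum (Finset.range _) _ (‖c‖ₑ ^ 2)]
  gcongr with x
  rw [← mul_div_assoc, Real.enorm_eq_ofReal ((abs_nonneg _).trans (hv x)), Pi.one_apply, one_pow,
    ENNReal.ofReal_one, mul_one, ← ENNReal.ofReal_pow ((abs_nonneg _).trans (hv x))]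
  exact ENNReal.div_le_div_right
    (ENNReal.ofReal_le_ofReal (sq_le_sq' (abs_le.1 (hv x)).1 (abs_le.1 (hv x)).2)) _

end WeightedSq

section LimitTheorem

variable {Ω Ω' : Type*} [MeasurableSpace Ω] [MeasurableSpace Ω'] {P : Measure Ω}
  [IsProbabilityMeasure P] {P' : Measure Ω'} [IsProbabilityMeasure P'] {p : ℕ → ℝ}
  {X : ℕ → Ω → ℕ} {Y : ℕ → Ω' → ℝ} {φ : ℕ → (ℕ → ℝ) → ℕ → ℝ}
  (hp : IsDecreasingPMF p) (hκ : BddAbove {x | 0 < p x}) (hφ : IsBlockOperator φ)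
include hp hκ hφ

theorem tendsto_localFluctuation (y₀ : ℕ → ℝ) :
    Tendsto (fun q : ℕ × (ℕ → ℝ) => localFluctuation φ p q.1 q.2) (atTop ×ˢ 𝓝 y₀)
      (𝓝 (limitFluctuation φ p y₀)) :=
  (((continuous_limitFluctuation hp hκ hφ).tendsto y₀).comp tendsto_snd).congr'
    ((eventually_localFluctuation_eq hp hκ hφ y₀).mono fun _ h => h.symm)

variable (hX : IsSample p X P)
include hX

theorem IsSample.ae_mixingFluctuation_estimator_eq_zero :
    ∀ᵐ ω ∂P, ∀ n x, supportEnd p < x → mixingFluctuation p (estimator φ X) n ω x = 0 := by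
  filter_upwards [hX.ae_mixingFluctuation_estimator_eq hp hκ hφ] with ω hω n x hx
  rw [hω, localFluctuation_eq_zero_of_lt hp hκ hφ n _ hx]

theorem IsSample.hasBoundedMoments_norm_toEll (k : ℝ≥0∞) [Fact (1 ≤ k)] :
    HasBoundedMoments (fun n ω => ‖toEll k (mixingFluctuation p (estimator φ X) n ω)‖) P := by
  refine (hX.hasBoundedMoments_sum_abs_empiricalFluctuation
    (Finset.range (supportEnd p + 1))).of_abs_le
      (A := (supportEnd p + 1) * (4 * (supportEnd p + 1))) fun n => ?_
  filter_upwards [hX.ae_mixingFluctuation_estimator_eq hp hκ hφ] with ω hω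
  rw [hω, abs_norm, abs_of_nonneg (Finset.sum_nonneg fun _ _ => abs_nonneg _), mul_assoc]
  refine (norm_toEll_le k fun x hx =>
    localFluctuation_eq_zero_of_lt hp hκ hφ n _ (Nat.lt_of_succ_le hx)).trans ?_
  refine (Finset.sum_le_card_nsmul _ _ _ fun x _ => abs_localFluctuation_le hp hκ hφ n _ x).trans ?_
  rw [Finset.card_range, nsmul_eq_mul, Nat.cast_succ]

theorem IsSample.exists_lintegral_sq_hellinger_le (hq : ∀ x ≤ supportEnd p, mixing p x ≠ 0) :
    ∃ C : ℝ≥0, ∀ n : ℕ,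
      ∫⁻ ω, (n * hellingerSq (mixing (estimator φ X n ω)) (mixing p)) ^ 2 ∂P ≤ C := by
  set S : ℕ → Ω → ℝ := fun n ω =>
    ∑ x ∈ Finset.range (supportEnd p + 1), |empiricalFluctuation p X n ω x|
  set A : ℝ := 4 * (supportEnd p + 1)
  obtain ⟨C, lintegral_le⟩ := (hX.hasBoundedMoments_sum_abs_empiricalFluctuation
    (Finset.range (supportEnd p + 1))).lintegral_pow_le (N := 4) (by norm_num)
  have mixing_nonneg_p := mixing_nonneg hp.antitone
  have weightedSq_ne_top : weightedSq p 1 ≠ ⊤ :=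
    (weightedSq_ne_top_iff mixing_nonneg_p).2 fun x hx h => absurd h (hq x hx)
  set B : ℝ≥0∞ := 8 * (‖A‖ₑ ^ 2 * weightedSq p 1)
  have B_ne_top : B ^ 2 ≠ ⊤ := by finiteness
  have hellinger_le : ∀ᵐ ω ∂P, ∀ n : ℕ,
      n * hellingerSq (mixing (estimator φ X n ω)) (mixing p) ≤ B * ‖S n ω‖ₑ ^ 2 := by
    filter_upwards [hX.ae_mixingFluctuation_estimator_eq hp hκ hφ] with ω hω n
    rw [natCast_mul_hellingerSq_eq, hω]
    calc hellingerStatistic p n (localFluctuation φ p n (empiricalFluctuation p X n ω))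
        ≤ 8 * weightedSq p (localFluctuation φ p n (empiricalFluctuation p X n ω)) :=
          hellingerStatistic_le mixing_nonneg_p fun x =>
            localFluctuation_eq_zero_of_lt hp hκ hφ n _
      _ ≤ 8 * (‖A * S n ω‖ₑ ^ 2 * weightedSq p 1) := by
          gcongr
          exact weightedSq_le_enorm_sq_mul (abs_localFluctuation_le hp hκ hφ n _)
      _ = B * ‖S n ω‖ₑ ^ 2 := by rw [enorm_mul]; ring
  refine ⟨(B ^ 2).toNNReal * C, fun n => ?_⟩
  calc ∫⁻ ω, (n * hellingerSq (mixing (estimator φ X n ω)) (mixing p)) ^ 2 ∂P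
      ≤ ∫⁻ ω, B ^ 2 * ‖S n ω‖ₑ ^ 4 ∂P := by
        refine lintegral_mono_ae (hellinger_le.mono fun ω hω => ?_)
        exact (pow_le_pow_left' (hω n) 2).trans_eq (by ring)
    _ = B ^ 2 * ∫⁻ ω, ‖S n ω‖ₑ ^ 4 ∂P := lintegral_const_mul' _ _ B_ne_top
    _ ≤ ((B ^ 2).toNNReal * C : ℝ≥0) := by
        rw [ENNReal.coe_mul, ENNReal.coe_toNNReal B_ne_top]
        gcongr
        exact lintegral_le n

variable (hY : IsLimitGaussian p Y P')
include hY

theorem tendstoInDistribution_mixingFluctuation {S : Type*} [TopologicalSpace S]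
    [MeasurableSpace S] [OpensMeasurableSpace S]
    {g : ℕ → (ℕ → ℝ) → S} {g' : (ℕ → ℝ) → S} (hg : ∀ n, Measurable (g n)) (hg' : Measurable g')
    (h : ∀ᵐ ω ∂P', Tendsto (fun q : ℕ × (ℕ → ℝ) => g q.1 (localFluctuation φ p q.1 q.2))
      (atTop ×ˢ 𝓝 fun x => Y x ω) (𝓝 (g' (limitFluctuation φ p fun x => Y x ω)))) :
    TendstoInDistribution (fun n ω => g n (mixingFluctuation p (estimator φ X) n ω)) atTop
      (fun ω => g' (mixing (blockwise φ p fun x => Y x ω))) (fun _ => P) P' := by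
  have tendsto_empirical := hX.tendstoInDistribution_empiricalFluctuation hp hκ hY
  have tendsto_local := tendstoInDistribution_of_tendsto_atTop_prod_nhds
    (g := fun n y => g n (localFluctuation φ p n y)) (g' := fun y => g' (limitFluctuation φ p y))
    tendsto_empirical
    (fun n => ((hg n).comp (continuous_localFluctuation hφ n).measurable).comp_aemeasurable
      (tendsto_empirical.forall_aemeasurable n))
    ((hg'.comp (continuous_limitFluctuation hp hκ hφ).measurable).comp_aemeasurable
      tendsto_empirical.aemeasurable_limit) h
  refine tendsto_local.congr (fun n => ?_) ?_
  · filter_upwards [hX.ae_mixingFluctuation_estimator_eq hp hκ hφ] with ω hω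
    rw [hω]
  · filter_upwards [hY.ae_limitFluctuation_eq hp hκ (φ := φ)] with ω hω
    rw [hω]

theorem weaklyConvergesInEll_estimator (k : ℝ≥0∞) [Fact (1 ≤ k)] :
    WeaklyConvergesInEll k (mixingFluctuation p (estimator φ X))
      (fun ω => mixing (blockwise φ p fun x => Y x ω)) P P' := by
  have eq_zero := hX.ae_mixingFluctuation_estimator_eq_zero hp hκ hφ
  have limit_eq_zero : ∀ᵐ ω ∂P', ∀ x, supportEnd p < x →
      mixing (blockwise φ p fun x => Y x ω) x = 0 := by
    filter_upwards [hY.ae_limitFluctuation_eq hp hκ (φ := φ)] with ω hω x hx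
    rw [← hω, limitFluctuation_eq_zero_of_lt _ hx]
  have continuous_sum := continuous_sum_single k (supportEnd p + 1)
  have tendsto_sum := tendstoInDistribution_mixingFluctuation hp hκ hφ hX hY
    (fun _ => continuous_sum.measurable) continuous_sum.measurable
    (ae_of_all _ fun ω => (continuous_sum.tendsto _).comp
      (tendsto_localFluctuation hp hκ hφ fun x => Y x ω))
  refine ⟨fun n => eq_zero.mono fun ω hω => memℓp_of_eq_zero k (hω n),
    limit_eq_zero.mono fun ω hω => memℓp_of_eq_zero k hω,
    tendsto_sum.congr (fun n => eq_zero.mono fun ω hω => ?_)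
      (limit_eq_zero.mono fun ω hω => ?_)⟩
  · exact (toEll_eq_sum k (hω n)).symm
  · exact (toEll_eq_sum k hω).symm

theorem tendstoInDistribution_hellinger_estimator :
    TendstoInDistribution
      (fun (n : ℕ) ω => (n : ℝ≥0∞) * hellingerSq (mixing (estimator φ X n ω)) (mixing p)) atTop
      (fun ω => weightedSq p (mixing (blockwise φ p fun x => Y x ω))) (fun _ => P) P' := by
  simp only [natCast_mul_hellingerSq_eq]
  refine tendstoInDistribution_mixingFluctuation hp hκ hφ hX hY (measurable_hellingerStatistic p)
    (measurable_weightedSq p) ?_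
  filter_upwards [hY.ae_limitFluctuation_ne_zero_or hp hκ hφ] with ω hω
  refine tendsto_hellingerStatistic (mixing_nonneg hp.antitone) tendsto_fst
    (tendsto_localFluctuation hp hκ hφ _)
    (fun q x => localFluctuation_eq_zero_of_lt hp hκ hφ q.1 q.2) fun x hx hq =>
      (hω x hx hq).imp_right fun eventually_eq_zero => ?_
  filter_upwards [eventually_localFluctuation_eq hp hκ hφ _, tendsto_snd.eventually
    eventually_eq_zero] with q local_eq limit_eq
  rw [local_eq, limit_eq]

theorem convergesInLawAndMeanENN_hellinger_estimator :
    ConvergesInLawAndMeanENN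
      (fun (n : ℕ) ω => (n : ℝ≥0∞) * hellingerSq (mixing (estimator φ X n ω)) (mixing p))
      (fun ω => weightedSq p (mixing (blockwise φ p fun x => Y x ω))) P P' := by
  have tendsto_law := tendstoInDistribution_hellinger_estimator hp hκ hφ hX hY
  refine ⟨tendsto_law, ?_⟩
  by_cases hq : ∃ x ≤ supportEnd p, mixing p x = 0
  · obtain ⟨x, hx, hqx⟩ := hq
    have lintegral_eq_top :
        ∫⁻ ω, weightedSq p (mixing (blockwise φ p fun x => Y x ω)) ∂P' = ⊤ := by
      by_contra lintegral_ne_top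
      refine hY.not_ae_limitFluctuation_eq_zero hp hκ hφ hx hqx ?_
      filter_upwards [ae_lt_top' tendsto_law.aemeasurable_limit lintegral_ne_top,
        hY.ae_limitFluctuation_eq hp hκ (φ := φ)] with ω lt_top limit_eq
      rw [limit_eq]
      exact (weightedSq_ne_top_iff (mixing_nonneg hp.antitone)).1 lt_top.ne
    have le_liminf := lintegral_le_liminf_of_tendstoInDistribution tendsto_law
    rw [lintegral_eq_top] at le_liminf ⊢
    exact tendsto_of_le_liminf_of_limsup_le le_liminf le_top
  · push Not at hq
    obtain ⟨C, hC⟩ := hX.exists_lintegral_sq_hellinger_le hp hκ hφ hq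
    exact tendsto_lintegral_of_lintegral_sq_le tendsto_law hC

theorem mixingRate_estimator :
    MixingRate p (estimator φ X) (fun ω => blockwise φ p fun x => Y x ω) P P' := by
  refine ⟨fun k one_le => ?_, convergesInLawAndMeanENN_hellinger_estimator hp hκ hφ hX hY⟩
  have weakly := weaklyConvergesInEll_estimator hp hκ hφ hX hY k
  have bounded := hX.hasBoundedMoments_norm_toEll hp hκ hφ k
  refine ⟨weakly, bounded.convergesInLawAndMean
    (TendstoInDistribution.continuous_comp continuous_norm weakly.2.2)
    (fun _ _ => norm_nonneg _) fun _ => norm_nonneg _, fun k_ne_top => ?_⟩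
  have one_le_toReal : 1 ≤ k.toReal := by
    simpa using ENNReal.toReal_mono k_ne_top one_le.out
  have bounded_rpow := bounded.abs_rpow one_le_toReal
  simp only [abs_norm] at bounded_rpow
  exact bounded_rpow.convergesInLawAndMean
    (TendstoInDistribution.continuous_comp (g := fun v : Ell k => ‖v‖ ^ k.toReal)
      (continuous_norm.rpow_const fun _ => Or.inr ENNReal.toReal_nonneg) weakly.2.2)
    (fun _ _ => by positivity) fun _ => by positivity

end LimitTheorem

end

end DiscreteMonotone

theorem mainTheorem11
    {Ω Ω' : Type*} [MeasurableSpace Ω] [MeasurableSpace Ω']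
    (P : Measure Ω) [IsProbabilityMeasure P] (P' : Measure Ω') [IsProbabilityMeasure P']
    (p : ℕ → ℝ) (hp : DiscreteMonotone.IsDecreasingPMF p) (hκ : BddAbove {x | 0 < p x})
    (X : ℕ → Ω → ℕ) (hX : ∀ i, Measurable (X i)) (hindep : iIndepFun X P)
    (hlaw : ∀ i x, P.real {ω | X i ω = x} = p x)
    (Y : ℕ → Ω' → ℝ) (hY : DiscreteMonotone.IsLimitGaussian p Y P') :
    DiscreteMonotone.MixingRate p (DiscreteMonotone.empirical X) (fun ω x => Y x ω) P P' ∧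
    DiscreteMonotone.MixingRate p (DiscreteMonotone.rearEstimator X)
      (DiscreteMonotone.limitRear p Y) P P' ∧
    DiscreteMonotone.MixingRate p (DiscreteMonotone.grenEstimator X)
      (DiscreteMonotone.limitGren p Y) P P' := by
  open DiscreteMonotone in
  have hS : IsSample p X P := ⟨hX, hindep, hlaw⟩
  refine ⟨?_, mixingRate_estimator hp hκ isBlockOperator_rear hS hY,
    mixingRate_estimator hp hκ isBlockOperator_gren hS hY⟩
  simpa only [estimator_truncate, blockwise_truncate hp hκ] using
    mixingRate_estimator hp hκ isBlockOperator_truncate hS hY
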